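/- Let $n\in\mathbb{N}$, $T>0$, and let $\kappa,R,m:\mathbb{R}\to\mathbb{R}^{n\times n}$ be continuous and $T$-periodic, with $\kappa(t)$ and $m(t)$ symmetric and $m(t)$ invertible for every $t$. Put $$J=\begin{pmatrix}0&I_n\\-I_n&0\end{pmatrix},\qquad A(t)=\begin{pmatrix}\kappa(t)&R(t)\\R(t)^{\top}&m(t)^{-1}\end{pmatrix}.$$ The linear Hamiltonian system $\dot z=JA(t)z$ on $\mathbb{R}^{2n}$ is called stable if each of its solutions $z$ (that is, the solution for every initial value $z(0)\in\mathbb{R}^{2n}$) is bounded on $[0,\infty)$. Then the system is stable if and only if there is a differentiable function $w:\mathbb{R}\to\mathbb{R}^{n\times n}$ with $w(t)$ invertible for every $t$ such that (i) $\dot w m-wRm$ is differentiable and $w$ satisfies the envelope equation $$\frac{d}{dt}\left(\dot w m-wRm\right)+\dot w mR^{\top}+w\left(\kappa-RmR^{\top}\right)-\left(w^{\top}w\,m\,w^{\top}\right)^{-1}=0\quad\text{on }\mathbb{R};$$ (ii) the matrix $S_0=S(0)$ is symplectic (i.e. $S_0JS_0^{\top}=J$), where $$S(t)=\begin{pmatrix}(w^{\top})^{-1}&0\\(wR-\dot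 w)m&w\end{pmatrix};$$ (iii) $|w|=\sqrt{w^{\top}w}$ (the positive semidefinite square root) is $T$-periodic, i.e. $|w(t+T)|=|w(t)|$ for all $t\in\mathbb{R}$. -/

import Mathlib

namespace LinHam

open scoped MatrixOrder

/-- Real `n × n` matrices. -/
abbrev Mat (n : ℕ) := Matrix (Fin n) (Fin n) ℝ

/-- The phase space `ℝ^{2n}`, with coordinates `z = (x, p)`. -/
abbrev Phase (n : ℕ) := Fin n ⊕ Fin n → ℝ

/-- The standard symplectic matrix `[[0, I], [-I, 0]]` (the negative of `Matrix.J`). -/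
def stdJ (n : ℕ) : Matrix (Fin n ⊕ Fin n) (Fin n ⊕ Fin n) ℝ :=
  Matrix.fromBlocks 0 1 (-1) 0

/-- The matrix `A = [[κ, R], [Rᵀ, m⁻¹]]` of the quadratic Hamiltonian `H = (1/2) zᵀ A z`. -/
noncomputable def hamMatrix {n : ℕ} (κ R m : Mat n) :
    Matrix (Fin n ⊕ Fin n) (Fin n ⊕ Fin n) ℝ :=
  Matrix.fromBlocks κ R R.transpose m⁻¹

/-- `z` solves the linear Hamiltonian system `ż = J A(t) z`. -/
def IsHamSolution {n : ℕ} (κ R m : ℝ → Mat n) (z : ℝ → Phase n) : Prop :=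
  ∀ t, HasDerivAt z ((stdJ n * hamMatrix (κ t) (R t) (m t)).mulVec (z t)) t

/-- Stability: every solution, whatever its value at time `0`, stays bounded as `t → ∞`. -/
def IsStable {n : ℕ} (κ R m : ℝ → Mat n) : Prop :=
  ∀ z : ℝ → Phase n, IsHamSolution κ R m z → ∃ C : ℝ, ∀ t, 0 ≤ t → ‖z t‖ ≤ C

/-- `w` is a (global, classical) solution of the envelope equation
`d/dt (ẇ m - w R m) + ẇ m Rᵀ + w (κ - R m Rᵀ) - (wᵀ w m wᵀ)⁻¹ = 0`.
Since `⁻¹` of a singular matrix is a junk value, invertibility of `w t` is spelled out; likewise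
the existence of the two derivatives that occur. -/
def IsEnvelopeSolution {n : ℕ} (κ R m w : ℝ → Mat n) : Prop :=
  (∀ t, IsUnit (w t).det) ∧
  Differentiable ℝ w ∧
  Differentiable ℝ (fun s => deriv w s * m s - w s * R s * m s) ∧
  ∀ t, deriv (fun s => deriv w s * m s - w s * R s * m s) t
      + deriv w t * m t * (R t).transpose
      + w t * (κ t - R t * m t * (R t).transpose)
      - ((w t).transpose * w t * m t * (w t).transpose)⁻¹ = 0

/-- The matrix `S(t) = [[(wᵀ)⁻¹, 0], [(w R - ẇ) m, w]]`. -/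
noncomputable def envelopeS {n : ℕ} (R m w : ℝ → Mat n) (t : ℝ) :
    Matrix (Fin n ⊕ Fin n) (Fin n ⊕ Fin n) ℝ :=
  Matrix.fromBlocks ((w t).transpose)⁻¹ 0 ((w t * R t - deriv w t) * m t) (w t)

/-- `|w| = √(wᵀ w)`, the positive semidefinite square root. -/
noncomputable def matAbs {n : ℕ} (w : Mat n) : Mat n :=
  CFC.sqrt (w.transpose * w)

end LinHam

namespace LinHam

open scoped MatrixOrder Matrix

/-! ### Linear differential equations: uniqueness by Gronwall, global existence by the Peano–Baker
series -/

section LinearODE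

variable {E : Type*} [NormedAddCommGroup E] [NormedSpace ℝ E]

/-! Let `Φ` be the fundamental matrix with `Φ 0 = 1`, and let `M = Φ T`, which is symplectic.

Stability implies envelope. The powers `M ^ k`, `k ≥ 0`, are bounded, so the averages of `M ^ k * (M
^ k)ᵀ` have a limit point `H` with `M * H * Mᵀ = H`. It is positive definite because the symplectic
relation also bounds the inverses of the powers (`exists_posDef_of_pow_bounded`). A polar
decomposition of a skew matrix replaces `H` by an invariant form that is itself symplectic
(`exists_posDef_mem_symplecticGroup`). Then `F = Φ * H * Φᵀ` is `T`-periodic, positive definite and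
symplectic. With blocks `a`, `b`, `bᵀ`, `d`, one seeks `w` with `wᵀ * w = a` and momentum `ẇ m - w R
m = (wᵀ)⁻¹ * b`. These amount to a linear equation for `w`, and the envelope equation becomes `ḃ`
rewritten with the symplectic relation `a * d - b * b = 1` (`exists_envelope_of_covariance`). Since
`|w| = √a`, periodicity is inherited from `F`.

Envelope implies stability. In the coordinates `S z` the system reads `ẏ₁ = G y₂`, `ẏ₂ = -G y₁` with
`G` symmetric, so the Euclidean length of `S z` is conserved. Hence the position `x = wᵀ y₁` is
bounded, as `wᵀ * w` is periodic. Neither `w` nor `ẇ` need be periodic, so the momentum is not read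
off from `S`. It is controlled by observability instead: on a window of length `T` the position
determines the solution, with a constant independent of the window
(`IsHamSolution.bounded_of_position_bounded`). -/

theorem eq_zero_of_norm_deriv_le_right {x x' : ℝ → E} {k : ℝ → ℝ} {t₀ t : ℝ}
    (hk : Continuous k) (hx : ∀ s, HasDerivAt x (x' s) s) (hb : ∀ s, ‖x' s‖ ≤ k s * ‖x s‖)
    (h₀ : x t₀ = 0) (ht : t₀ ≤ t) : x t = 0 := by
  obtain ⟨K, hK⟩ := (isCompact_Icc (a := t₀) (b := t)).bddAbove_image hk.continuousOn
  refine eq_zero_of_abs_deriv_le_mul_abs_self_of_eq_zero_right (K := K) (a := t₀) (b := t)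
    (f' := x') (fun s _ => (hx s).continuousAt.continuousWithinAt)
    (fun s _ => (hx s).hasDerivWithinAt) h₀ (fun s hs => ?_) t ⟨ht, le_rfl⟩
  exact (hb s).trans (mul_le_mul_of_nonneg_right
    (hK ⟨s, ⟨hs.1, hs.2.le⟩, rfl⟩) (norm_nonneg _))

theorem eq_zero_of_norm_deriv_le {x x' : ℝ → E} {k : ℝ → ℝ} {t₀ : ℝ}
    (hk : Continuous k) (hx : ∀ s, HasDerivAt x (x' s) s) (hb : ∀ s, ‖x' s‖ ≤ k s * ‖x s‖)
    (h₀ : x t₀ = 0) (t : ℝ) : x t = 0 := by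
  rcases le_total t₀ t with h | h
  · exact eq_zero_of_norm_deriv_le_right hk hx hb h₀ h
  · have := eq_zero_of_norm_deriv_le_right (x := fun s => x (-s)) (x' := fun s => -x' (-s))
      (k := fun s => k (-s)) (t₀ := -t₀) (t := -t) (by fun_prop)
      (fun s => by simpa [Function.comp_def] using (hx (-s)).scomp s (hasDerivAt_neg s))
      (fun s => by simpa using hb (-s)) (by simpa using h₀) (by linarith)
    simpa using this

/-- Terms of the Peano–Baker series of `ẋ = B(t) x`. -/
noncomputable def peanoBakerTerm (B : ℝ → E →L[ℝ] E) (x₀ : E) : ℕ → ℝ → E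
  | 0 => fun _ => x₀
  | k + 1 => fun t => ∫ s in (0 : ℝ)..t, B s (peanoBakerTerm B x₀ k s)

theorem continuous_peanoBakerTerm {B : ℝ → E →L[ℝ] E} (hB : Continuous B) (x₀ : E) (k : ℕ) :
    Continuous (peanoBakerTerm B x₀ k) := by
  induction k with
  | zero => exact continuous_const
  | succ k ih =>
    exact intervalIntegral.continuous_primitive
      (fun a b => (hB.clm_apply ih).intervalIntegrable a b) 0

/-- Each integration of the bound for the previous term raises the power of `|t|` by one and
supplies the next factor of the factorial. -/
theorem norm_peanoBakerTerm_le {B : ℝ → E →L[ℝ] E} (hB : Continuous B) (x₀ : E) {a K : ℝ}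
    (hK : ∀ t ∈ Set.Ioo (-a) a, ‖B t‖ ≤ K) (k : ℕ) {t : ℝ} (ht : t ∈ Set.Ioo (-a) a) :
    ‖peanoBakerTerm B x₀ k t‖ ≤ (K * |t|) ^ k / k.factorial * ‖x₀‖ := by
  have hK0 : 0 ≤ K := (norm_nonneg _).trans (hK t ht)
  induction k generalizing t with
  | zero => simp [peanoBakerTerm]
  | succ k ih =>
    have hc := hB.clm_apply (continuous_peanoBakerTerm hB x₀ k)
    have hsub : Set.uIoc 0 t ⊆ Set.Ioo (-a) a := fun s hs => by
      obtain ⟨h1, h2⟩ := ht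
      rcases Set.mem_uIoc.1 hs with h | h <;> constructor <;> linarith [h.1, h.2]
    have hg : Continuous fun s : ℝ => K ^ (k + 1) / k.factorial * ‖x₀‖ * |s - 0| ^ k := by
      fun_prop
    calc ‖peanoBakerTerm B x₀ (k + 1) t‖
        ≤ ∫ s in Set.uIoc 0 t, ‖B s (peanoBakerTerm B x₀ k s)‖ :=
          intervalIntegral.norm_integral_le_integral_norm_uIoc
      _ ≤ ∫ s in Set.uIoc 0 t, K ^ (k + 1) / k.factorial * ‖x₀‖ * |s - 0| ^ k := by
          refine MeasureTheory.setIntegral_mono_on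
            (hc.norm.intervalIntegrable 0 t).def' (hg.intervalIntegrable 0 t).def'
            measurableSet_uIoc fun s hs => ?_
          calc ‖B s (peanoBakerTerm B x₀ k s)‖ ≤ ‖B s‖ * ‖peanoBakerTerm B x₀ k s‖ :=
                (B s).le_opNorm _
            _ ≤ K * ((K * |s|) ^ k / k.factorial * ‖x₀‖) :=
                mul_le_mul (hK s (hsub hs)) (ih (hsub hs)) (norm_nonneg _) hK0
            _ = _ := by rw [sub_zero, mul_pow]; ring
      _ = (K * |t|) ^ (k + 1) / (k + 1).factorial * ‖x₀‖ := by
          rw [MeasureTheory.integral_const_mul, integral_pow_abs_sub_uIoc, sub_zero,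
            Nat.factorial_succ, mul_pow]
          push_cast
          field_simp

variable [CompleteSpace E]

theorem hasDerivAt_peanoBakerTerm_succ {B : ℝ → E →L[ℝ] E} (hB : Continuous B) (x₀ : E) (k : ℕ)
    (t : ℝ) : HasDerivAt (peanoBakerTerm B x₀ (k + 1)) (B t (peanoBakerTerm B x₀ k t)) t := by
  have hc := hB.clm_apply (continuous_peanoBakerTerm hB x₀ k)
  exact intervalIntegral.integral_hasDerivAt_right (hc.intervalIntegrable _ _)
    (hc.stronglyMeasurableAtFilter _ _) hc.continuousAt

/-- The Peano–Baker series is dominated by an exponential series on every bounded interval, so it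
can be differentiated term by term. The derivative of each term is `B` applied to the preceding one,
and the solution is global because the equation is linear. -/
theorem exists_hasDerivAt_clm_apply {B : ℝ → E →L[ℝ] E} (hB : Continuous B) (x₀ : E) :
    ∃ x : ℝ → E, x 0 = x₀ ∧ ∀ t, HasDerivAt x (B t (x t)) t := by
  obtain ⟨X, hX⟩ : ∃ X, X = peanoBakerTerm B x₀ := ⟨_, rfl⟩
  have hX0 : ∀ k, X (k + 1) 0 = 0 := fun k => hX ▸ intervalIntegral.integral_same
  have hval : ∀ t, ∃ K : ℝ, 0 ≤ K ∧ ∀ s ∈ Set.Ioo (-(|t| + 1)) (|t| + 1), ‖B s‖ ≤ K := by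
    intro t
    obtain ⟨K, hK⟩ := (isCompact_Icc (a := -(|t| + 1)) (b := |t| + 1)).bddAbove_image
      hB.norm.continuousOn
    exact ⟨max K 0, le_max_right _ _,
      fun s hs => (hK ⟨s, ⟨hs.1.le, hs.2.le⟩, rfl⟩).trans (le_max_left _ _)⟩
  have hmem : ∀ t : ℝ, t ∈ Set.Ioo (-(|t| + 1)) (|t| + 1) := fun t =>
    ⟨by linarith [neg_abs_le t], by linarith [le_abs_self t]⟩
  have hsum : ∀ t, Summable fun k => X k t := by
    intro t
    obtain ⟨K, _, hK⟩ := hval t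
    exact Summable.of_norm_bounded ((Real.summable_pow_div_factorial (K * |t|)).mul_right ‖x₀‖)
      fun k => hX ▸ norm_peanoBakerTerm_le hB x₀ hK k (hmem t)
  -- The constant zeroth term is split off: the remaining terms vanish at `0`, which gives the
  -- initial value, and differentiation shifts their index down by one.
  refine ⟨fun t => x₀ + ∑' k, X (k + 1) t, by simp [hX0], fun t => ?_⟩
  obtain ⟨K, hK0, hK⟩ := hval t
  have hu : Summable fun k : ℕ => K * ((K * (|t| + 1)) ^ k / k.factorial * ‖x₀‖) :=
    ((Real.summable_pow_div_factorial (K * (|t| + 1))).mul_right ‖x₀‖).mul_left K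
  have hder : HasDerivAt (fun t => ∑' k, X (k + 1) t) (∑' k, B t (X k t)) t := by
    refine hasDerivAt_tsum_of_isPreconnected
      (u := fun k => K * ((K * (|t| + 1)) ^ k / k.factorial * ‖x₀‖))
      (g' := fun k s => B s (X k s)) (y₀ := 0)
      (t := Set.Ioo (-(|t| + 1)) (|t| + 1)) hu isOpen_Ioo isPreconnected_Ioo
      (fun k s _ => hX ▸ hasDerivAt_peanoBakerTerm_succ hB x₀ k s) (fun k s hs => ?_)
      ⟨by linarith [abs_nonneg t], by linarith [abs_nonneg t]⟩
      (by simp only [hX0]; exact summable_zero) (hmem t)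
    refine ((B s).le_opNorm _).trans (mul_le_mul (hK s hs)
      ((hX ▸ norm_peanoBakerTerm_le hB x₀ hK k hs).trans ?_) (norm_nonneg _) hK0)
    gcongr
    exact (abs_lt.2 hs).le
  have heq : x₀ + ∑' k, X (k + 1) t = ∑' k, X k t := by
    rw [(hsum t).tsum_eq_zero_add, hX]; rfl
  simp only [heq]
  rw [(B t).map_tsum (hsum t)]
  exact hder.const_add x₀

end LinearODE

/-! ### Calculus of matrix-valued functions -/

section MatrixCalculus

variable {ι ι' ι'' : Type*} [Fintype ι] [Fintype ι'] [Fintype ι'']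

attribute [local instance] Matrix.normedAddCommGroup Matrix.normedSpace in
theorem hasDerivAt_matrix_iff {ι ι' : Type*} [Fintype ι] [Fintype ι'] {f : ℝ → Matrix ι ι' ℝ} {f' : Matrix ι ι' ℝ} {t : ℝ} :
    HasDerivAt f f' t ↔ ∀ i j, HasDerivAt (fun s => f s i j) (f' i j) t := by
  refine (hasDerivAt_pi (φ := f) (φ' := f')).trans (forall_congr' fun i => ?_)
  exact hasDerivAt_pi
theorem _root_.HasDerivAt.matrix_mul {f : ℝ → Matrix ι ι' ℝ} {g : ℝ → Matrix ι' ι'' ℝ}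
    {f' : Matrix ι ι' ℝ} {g' : Matrix ι' ι'' ℝ} {t : ℝ} (hf : HasDerivAt f f' t)
    (hg : HasDerivAt g g' t) : HasDerivAt (fun s => f s * g s) (f' * g t + f t * g') t := by
  rw [hasDerivAt_matrix_iff] at *
  intro i j
  simp only [Matrix.mul_apply, Matrix.add_apply, ← Finset.sum_add_distrib]
  exact HasDerivAt.fun_sum fun k _ => (hf i k).mul (hg k j)

theorem _root_.HasDerivAt.matrix_transpose {f : ℝ → Matrix ι ι' ℝ} {f' : Matrix ι ι' ℝ} {t : ℝ}
    (hf : HasDerivAt f f' t) : HasDerivAt (fun s => (f s)ᵀ) f'ᵀ t := by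
  rw [hasDerivAt_matrix_iff] at *
  exact fun i j => hf j i

theorem _root_.HasDerivAt.matrix_mulVec {f : ℝ → Matrix ι ι' ℝ} {g : ℝ → ι' → ℝ}
    {f' : Matrix ι ι' ℝ} {g' : ι' → ℝ} {t : ℝ} (hf : HasDerivAt f f' t)
    (hg : HasDerivAt g g' t) : HasDerivAt (fun s => f s *ᵥ g s) (f' *ᵥ g t + f t *ᵥ g') t := by
  rw [hasDerivAt_matrix_iff] at hf
  rw [hasDerivAt_pi] at *
  intro i
  simp only [Matrix.mulVec, dotProduct, Pi.add_apply, ← Finset.sum_add_distrib]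
  exact HasDerivAt.fun_sum fun k _ => (hf i k).mul (hg k)

attribute [local instance] Matrix.linftyOpNormedRing Matrix.linftyOpNormedAlgebra in
theorem exists_hasDerivAt_matrix_mul [DecidableEq ι] {B : ℝ → Matrix ι ι ℝ} (hB : Continuous B)
    (X₀ : Matrix ι ι ℝ) :
    ∃ X : ℝ → Matrix ι ι ℝ, X 0 = X₀ ∧ ∀ t, HasDerivAt X (B t * X t) t := by
  obtain ⟨X, h0, hX⟩ := exists_hasDerivAt_clm_apply
    (B := fun t => ContinuousLinearMap.mul ℝ (Matrix ι ι ℝ) (B t)) (by fun_prop) X₀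
  exact ⟨X, h0, hX⟩

attribute [local instance] Matrix.linftyOpNormedRing Matrix.linftyOpNormedAlgebra in
-- The two-sided form covers Lyapunov equations, which govern `Φ * H * Φᵀ` and `wᵀ * w`. The
-- difference of two solutions satisfies the same equation, so Gronwall applies.
theorem matrix_eq_of_hasDerivAt [DecidableEq ι] {A B : ℝ → Matrix ι ι ℝ} (hA : Continuous A)
    (hB : Continuous B) {X Y : ℝ → Matrix ι ι ℝ}
    (hX : ∀ t, HasDerivAt X (A t * X t + X t * B t) t)
    (hY : ∀ t, HasDerivAt Y (A t * Y t + Y t * B t) t) {t₀ : ℝ} (h₀ : X t₀ = Y t₀) : X = Y := by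
  funext t
  rw [← sub_eq_zero]
  refine eq_zero_of_norm_deriv_le (x := fun t => X t - Y t) (k := fun t => ‖A t‖ + ‖B t‖)
    (by fun_prop) (fun s => (hX s).sub (hY s)) (fun s => ?_) (sub_eq_zero.2 h₀) t
  calc ‖A s * X s + X s * B s - (A s * Y s + Y s * B s)‖
      = ‖A s * (X s - Y s) + (X s - Y s) * B s‖ := by congr 1; noncomm_ring
    _ ≤ ‖A s‖ * ‖X s - Y s‖ + ‖X s - Y s‖ * ‖B s‖ :=
        (norm_add_le _ _).trans (add_le_add (norm_mul_le _ _) (norm_mul_le _ _))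
    _ = _ := by ring

theorem matrix_eq_of_hasDerivAt_left [DecidableEq ι] {A : ℝ → Matrix ι ι ℝ} (hA : Continuous A)
    {X Y : ℝ → Matrix ι ι ℝ} (hX : ∀ t, HasDerivAt X (A t * X t) t)
    (hY : ∀ t, HasDerivAt Y (A t * Y t) t) {t₀ : ℝ} (h₀ : X t₀ = Y t₀) : X = Y :=
  matrix_eq_of_hasDerivAt hA (B := 0) continuous_const (by simpa using hX) (by simpa using hY) h₀

attribute [local instance] Matrix.linftyOpNormedRing Matrix.linftyOpNormedAlgebra in
theorem mulVec_eq_of_hasDerivAt [DecidableEq ι] {A : ℝ → Matrix ι ι ℝ} (hA : Continuous A)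
    {x y : ℝ → ι → ℝ} (hx : ∀ t, HasDerivAt x (A t *ᵥ x t) t)
    (hy : ∀ t, HasDerivAt y (A t *ᵥ y t) t) {t₀ : ℝ} (h₀ : x t₀ = y t₀) : x = y := by
  funext t
  rw [← sub_eq_zero]
  refine eq_zero_of_norm_deriv_le (x := fun t => x t - y t) (k := fun t => ‖A t‖)
    (by fun_prop) (fun s => (hx s).sub (hy s)) (fun s => ?_) (sub_eq_zero.2 h₀) t
  rw [← Matrix.mulVec_sub]
  exact Matrix.linfty_opNorm_mulVec _ _

attribute [local instance] Matrix.normedAddCommGroup Matrix.normedSpace in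
theorem matrix_hasDerivAt_deriv {f : ℝ → Matrix ι ι' ℝ} (hf : Differentiable ℝ f) (t : ℝ) :
    HasDerivAt f (deriv f t) t := (hf t).hasDerivAt

attribute [local instance] Matrix.normedAddCommGroup Matrix.normedSpace in
theorem differentiable_of_matrix_hasDerivAt {f f' : ℝ → Matrix ι ι' ℝ}
    (hf : ∀ t, HasDerivAt f (f' t) t) : Differentiable ℝ f := fun t => (hf t).differentiableAt

attribute [local instance] Matrix.normedAddCommGroup Matrix.normedSpace in
theorem _root_.HasDerivAt.matrix_deriv {f : ℝ → Matrix ι ι' ℝ} {f' : Matrix ι ι' ℝ} {t : ℝ}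
    (hf : HasDerivAt f f' t) : deriv f t = f' := hf.deriv

attribute [local instance] Matrix.normedAddCommGroup Matrix.normedSpace in
theorem continuous_of_matrix_hasDerivAt {f f' : ℝ → Matrix ι ι' ℝ}
    (hf : ∀ t, HasDerivAt f (f' t) t) : Continuous f :=
  continuous_iff_continuousAt.2 fun t => (hf t).continuousAt

attribute [local instance] Matrix.normedAddCommGroup Matrix.normedSpace in
theorem matrix_eq_const_of_hasDerivAt_zero {f : ℝ → Matrix ι ι' ℝ}
    (hf : ∀ t, HasDerivAt f 0 t) (s t : ℝ) : f s = f t :=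
  is_const_of_deriv_eq_zero (fun t => (hf t).differentiableAt) (fun t => (hf t).deriv) s t

attribute [local instance] Matrix.linftyOpNormedRing Matrix.linftyOpNormedAlgebra in
theorem _root_.HasDerivAt.matrix_inv [DecidableEq ι] {f : ℝ → Matrix ι ι ℝ} {f' : Matrix ι ι ℝ}
    {t : ℝ} (hf : HasDerivAt f f' t) (hu : IsUnit (f t).det) :
    HasDerivAt (fun s => (f s)⁻¹) (-((f t)⁻¹ * f' * (f t)⁻¹)) t := by
  obtain ⟨u, hu⟩ := (Matrix.isUnit_iff_isUnit_det _).2 hu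
  have h := (hu ▸ hasFDerivAt_ringInverse (𝕜 := ℝ) u :
    HasFDerivAt _ _ (f t)).comp_hasDerivAt t hf
  simp only [Function.comp_def, ← Matrix.nonsing_inv_eq_ringInverse] at h
  have key : (-((ContinuousLinearMap.mulLeftRight ℝ (Matrix ι ι ℝ)) ↑u⁻¹) ↑u⁻¹) f' =
      -((f t)⁻¹ * f' * (f t)⁻¹) := by
    rw [← hu, ← Matrix.coe_units_inv]
    simp [mul_assoc]
  rw [key] at h
  exact h

end MatrixCalculus

/-! ### Invariant positive definite forms of a symplectic matrix with bounded powers -/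

section SymplecticNormalForm

variable {l : Type*} [Fintype l] [DecidableEq l]

open Matrix in
theorem isUnit_det_of_mul_J_mul {K r : Matrix (l ⊕ l) (l ⊕ l) ℝ}
    (hK : r * K * r = J l ℝ) : IsUnit K.det := by
  have h : IsUnit (r * K * r).det := hK ▸ isUnit_det_J l ℝ
  rw [det_mul, det_mul] at h
  exact isUnit_of_mul_isUnit_right (isUnit_of_mul_isUnit_left h)

open Matrix in
-- With `r = √H`, the matrix `N = r⁻¹ M r` is orthogonal and commutes with the skew matrix `K = r⁻¹
-- J r⁻¹`, hence with `D = |K|`. So `r D r` is still invariant, and it is symplectic because `D * D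
-- = -K * K` turns `(r D r) J (r D r)` into `r K r = J`.
theorem exists_posDef_mem_symplecticGroup {M H : Matrix (l ⊕ l) (l ⊕ l) ℝ}
    (hM : M ∈ symplecticGroup l ℝ) (hH : H.PosDef) (hMH : M * H * Mᵀ = H) :
    ∃ H' : Matrix (l ⊕ l) (l ⊕ l) ℝ,
      H'.PosDef ∧ M * H' * Mᵀ = H' ∧ H' ∈ symplecticGroup l ℝ := by
  set r := CFC.sqrt H with hr
  have hrr : r * r = H := CFC.sqrt_mul_sqrt_self H hH.posSemidef.nonneg
  have hrp : r.PosSemidef := (CFC.sqrt_nonneg H).posSemidef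
  have hru : IsUnit r.det := by
    have := (isUnit_iff_isUnit_det H).1 hH.isUnit
    rw [← hrr, det_mul] at this
    exact isUnit_of_mul_isUnit_left this
  have hrt : rᵀ = r := by simpa using hrp.isHermitian.eq
  have h1 : r * r⁻¹ = 1 := mul_nonsing_inv r hru
  have h2 : r⁻¹ * r = 1 := nonsing_inv_mul r hru
  have hrit : r⁻¹ᵀ = r⁻¹ := by rw [transpose_nonsing_inv, hrt]
  set K := r⁻¹ * J l ℝ * r⁻¹ with hK
  have hKJ : r * K * r = J l ℝ := by
    calc r * K * r = (r * r⁻¹) * J l ℝ * (r⁻¹ * r) := by rw [hK]; noncomm_ring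
      _ = _ := by rw [h1, h2]; simp
  have hKt : Kᵀ = -K := by
    simp [hK, transpose_mul, hrit, J_transpose, mul_assoc]
  have hKu : IsUnit K.det := isUnit_det_of_mul_J_mul hKJ
  have hKi : K * -(r * J l ℝ * r) = 1 := by
    calc K * -(r * J l ℝ * r) = -(r⁻¹ * J l ℝ * (r⁻¹ * r) * J l ℝ * r) := by
          rw [hK]; noncomm_ring
      _ = -(r⁻¹ * (J l ℝ * J l ℝ) * r) := by rw [h2]; noncomm_ring
      _ = 1 := by rw [J_squared]; simp [h2]
  have hrJr : r * J l ℝ * r = -K⁻¹ := by rw [inv_eq_right_inv hKi, neg_neg]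
  set N := r⁻¹ * M * r with hN
  have hNr : r * N = M * r := by
    rw [hN, ← mul_assoc, ← mul_assoc, h1, one_mul]
  have hrN : Nᵀ * r = r * Mᵀ := by
    have := congrArg transpose hNr
    rwa [transpose_mul r N, transpose_mul M r, hrt] at this
  have hNN : N * Nᵀ = 1 := by
    calc N * Nᵀ = r⁻¹ * (M * (r * r) * Mᵀ) * r⁻¹ := by
          rw [hN]; simp only [transpose_mul, hrt, hrit]; noncomm_ring
      _ = (r⁻¹ * r) * (r * r⁻¹) := by rw [hrr, hMH, ← hrr]; noncomm_ring
      _ = 1 := by rw [h1, h2, one_mul]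
  have hNN' : Nᵀ * N = 1 := mul_eq_one_comm.1 hNN
  have hNK : N * K * Nᵀ = K := by
    calc N * K * Nᵀ = r⁻¹ * M * (r * K * r) * Mᵀ * r⁻¹ := by
          rw [hN]; simp only [transpose_mul, hrt, hrit]; noncomm_ring
      _ = r⁻¹ * (M * J l ℝ * Mᵀ) * r⁻¹ := by rw [hKJ]; noncomm_ring
      _ = K := by rw [SymplecticGroup.mem_iff.1 hM]
  have hcomm : Commute N K := by
    calc N * K = N * K * (Nᵀ * N) := by rw [hNN', mul_one]
      _ = (N * K * Nᵀ) * N := by noncomm_ring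
      _ = K * N := by rw [hNK]
  have hKK : (Kᵀ * K).PosSemidef := by
    simpa using posSemidef_conjTranspose_mul_self K
  set D := CFC.sqrt (Kᵀ * K) with hD
  have hDD : D * D = Kᵀ * K := CFC.sqrt_mul_sqrt_self _ hKK.nonneg
  have hDp : D.PosSemidef := (CFC.sqrt_nonneg _).posSemidef
  have hDt : Dᵀ = D := by simpa using hDp.isHermitian.eq
  have hDu : IsUnit D.det := by
    have : IsUnit (Kᵀ * K).det := by rw [det_mul, det_transpose]; exact hKu.mul hKu
    rw [← hDD, det_mul] at this
    exact isUnit_of_mul_isUnit_left this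
  -- `D` is a function of `Kᵀ * K = -K * K`, so it commutes with everything that commutes with `K`.
  have hND : Commute D N := by
    refine Commute.cfcₙ_nnreal ?_ _
    rw [hKt]
    exact (hcomm.neg_right.mul_right hcomm).symm
  have hKD : Commute D K := by
    refine Commute.cfcₙ_nnreal ?_ _
    rw [hKt]
    exact ((Commute.refl K).neg_right.mul_right (Commute.refl K)).symm
  have hpos : (r * D * r).PosSemidef := by
    have := hDp.conjTranspose_mul_mul_same r
    simpa [hrt] using this
  have hsq : (r * D * r) * J l ℝ * (r * D * r) = J l ℝ := by
    have hKK' : K⁻¹ * K = 1 := nonsing_inv_mul K hKu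
    have hK'K : K * K⁻¹ = 1 := mul_nonsing_inv K hKu
    have hDK : D * K⁻¹ = K⁻¹ * D := by
      calc D * K⁻¹ = K⁻¹ * (K * D) * K⁻¹ := by rw [← mul_assoc, hKK', one_mul]
        _ = K⁻¹ * D * (K * K⁻¹) := by rw [← hKD.eq]; noncomm_ring
        _ = _ := by rw [hK'K, mul_one]
    calc (r * D * r) * J l ℝ * (r * D * r) = r * (D * (r * J l ℝ * r) * D) * r := by noncomm_ring
      _ = -(r * ((D * K⁻¹) * D) * r) := by rw [hrJr]; noncomm_ring
      _ = -(r * (K⁻¹ * (D * D)) * r) := by rw [hDK]; noncomm_ring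
      _ = r * ((K⁻¹ * K) * K) * r := by rw [hDD, hKt]; noncomm_ring
      _ = J l ℝ := by rw [hKK', one_mul, hKJ]
  have ht : (r * D * r)ᵀ = r * D * r := by simp [transpose_mul, hrt, hDt, mul_assoc]
  refine ⟨r * D * r, (hpos.posDef_iff_isUnit).2 ?_, ?_, ?_⟩
  · rw [isUnit_iff_isUnit_det, det_mul, det_mul]
    exact (hru.mul hDu).mul hru
  · calc M * (r * D * r) * Mᵀ = (M * r) * D * (r * Mᵀ) := by noncomm_ring
      _ = r * (N * D) * Nᵀ * r := by rw [← hNr, ← hrN]; noncomm_ring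
      _ = r * D * (N * Nᵀ) * r := by rw [← hND.eq]; noncomm_ring
      _ = r * D * r := by rw [hNN, mul_one]
  · rw [SymplecticGroup.mem_iff, ht, hsq]

open Matrix in
theorem dotProduct_mulVec_self_le {ι : Type*} [Fintype ι] {A : Matrix ι ι ℝ} {C : ℝ}
    (hC : ∀ i j, |A i j| ≤ C) (v : ι → ℝ) :
    (A *ᵥ v) ⬝ᵥ (A *ᵥ v) ≤ (Fintype.card ι * (Fintype.card ι * C ^ 2)) * (v ⬝ᵥ v) := by
  have : ∀ i, (A *ᵥ v) i * (A *ᵥ v) i ≤ (Fintype.card ι * C ^ 2) * (v ⬝ᵥ v) := by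
    intro i
    rw [← sq]
    refine (Finset.sum_mul_sq_le_sq_mul_sq Finset.univ (A i) v).trans ?_
    have h1 : ∑ j, A i j ^ 2 ≤ Fintype.card ι * C ^ 2 := by
      refine (Finset.sum_le_sum (g := fun _ => C ^ 2) fun j _ =>
        sq_le_sq' (abs_le.1 (hC i j)).1 (abs_le.1 (hC i j)).2).trans ?_
      simp
    have h2 : ∑ j, v j ^ 2 = v ⬝ᵥ v := by simp [dotProduct, sq]
    rw [h2]
    exact mul_le_mul_of_nonneg_right h1 (by simpa using dotProduct_self_star_nonneg v)
  refine (Finset.sum_le_sum fun i _ => this i).trans ?_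
  simp [mul_assoc]

open Matrix in
/-- The Cesàro means `(1/N) ∑_{k<N} Mᵏ (Mᵏ)ᵀ`. -/
noncomputable def cesaroGram {ι : Type*} [Fintype ι] [DecidableEq ι] (M : Matrix ι ι ℝ) (N : ℕ) :
    Matrix ι ι ℝ :=
  ((N : ℝ) + 1)⁻¹ • ∑ k ∈ Finset.range (N + 1), M ^ k * (M ^ k)ᵀ

open Matrix in
-- Conjugation by `M` shifts the index, so the sum telescopes to its two end terms. Averaging over
-- `N + 1` powers keeps the denominator nonzero at `N = 0`.
theorem mul_cesaroGram_mul {ι : Type*} [Fintype ι] [DecidableEq ι] (M : Matrix ι ι ℝ) (N : ℕ) :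
    M * cesaroGram M N * Mᵀ =
      cesaroGram M N + ((N : ℝ) + 1)⁻¹ • (M ^ (N + 1) * (M ^ (N + 1))ᵀ - 1) := by
  have h : ∀ k, M * (M ^ k * (M ^ k)ᵀ) * Mᵀ = M ^ (k + 1) * (M ^ (k + 1))ᵀ := fun k => by
    rw [pow_succ' M k, transpose_mul]; noncomm_ring
  simp only [cesaroGram, mul_smul_comm, smul_mul_assoc, Finset.mul_sum, Finset.sum_mul, h]
  rw [← smul_add]
  congr 1
  have := Finset.sum_range_succ' (fun k => M ^ k * (M ^ k)ᵀ) (N + 1)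
  rw [Finset.sum_range_succ] at this
  simp only [pow_zero, transpose_one, mul_one] at this
  rw [← add_sub_assoc, this, add_sub_cancel_right]

theorem abs_mul_transpose_apply_le {ι : Type*} [Fintype ι] {A : Matrix ι ι ℝ} {C : ℝ}
    (hC : ∀ i j, |A i j| ≤ C) (i j : ι) : |(A * Aᵀ) i j| ≤ Fintype.card ι * (C * C) := by
  rw [Matrix.mul_apply]
  refine (Finset.abs_sum_le_sum_abs _ _).trans
    ((Finset.sum_le_sum (g := fun _ => C * C) fun k _ => ?_).trans (by simp))
  rw [abs_mul]
  exact mul_le_mul (hC i k) (hC j k) (abs_nonneg _) ((abs_nonneg _).trans (hC i k))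

theorem abs_cesaroGram_apply_le {ι : Type*} [Fintype ι] [DecidableEq ι] {M : Matrix ι ι ℝ} {C : ℝ}
    (hC : ∀ (k : ℕ) i j, |(M ^ k) i j| ≤ C) (N : ℕ) (i j : ι) :
    |cesaroGram M N i j| ≤ Fintype.card ι * (C * C) := by
  have hN : (0 : ℝ) < (N : ℝ) + 1 := by positivity
  simp only [cesaroGram, Matrix.smul_apply, Matrix.sum_apply, smul_eq_mul]
  rw [abs_mul, abs_of_pos (inv_pos.2 hN), inv_mul_le_iff₀ hN]
  refine (Finset.abs_sum_le_sum_abs _ _).trans ((Finset.sum_le_sum fun k _ =>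
    abs_mul_transpose_apply_le (hC k) i j).trans (by simp))

open Matrix in
-- From `J = M ^ k * J * (M ^ k)ᵀ` and the boundedness of `M ^ k`, the length of `v`, equal to that
-- of `J v`, is at most a constant times that of `(M ^ k)ᵀ v`. This uniform lower bound survives
-- averaging and passage to the limit.
theorem le_dotProduct_cesaroGram_mulVec {M : Matrix (l ⊕ l) (l ⊕ l) ℝ}
    (hM : M ∈ symplecticGroup l ℝ) {C : ℝ} (hC : ∀ (k : ℕ) i j, |(M ^ k) i j| ≤ C) (N : ℕ)
    (v : l ⊕ l → ℝ) :
    v ⬝ᵥ v ≤ (Fintype.card (l ⊕ l) * (Fintype.card (l ⊕ l) * C ^ 2)) *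
      (v ⬝ᵥ (cesaroGram M N *ᵥ v)) := by
  have hJ : ∀ u : l ⊕ l → ℝ, (J l ℝ *ᵥ u) ⬝ᵥ (J l ℝ *ᵥ u) = u ⬝ᵥ u := fun u => by
    rw [dotProduct_mulVec, vecMul_mulVec, ← dotProduct_mulVec, ← mulVec_mulVec, J_transpose,
      mulVec_mulVec, neg_mul, J_squared, neg_neg, one_mulVec]
  have hk : ∀ k : ℕ, v ⬝ᵥ v ≤ (Fintype.card (l ⊕ l) * (Fintype.card (l ⊕ l) * C ^ 2)) *
      (v ⬝ᵥ ((M ^ k * (M ^ k)ᵀ) *ᵥ v)) := by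
    intro k
    have hMk := SymplecticGroup.mem_iff.1 (pow_mem hM k)
    have h := dotProduct_mulVec_self_le (hC k) (J l ℝ *ᵥ ((M ^ k)ᵀ *ᵥ v))
    rw [hJ, mulVec_mulVec, mulVec_mulVec, hMk, hJ] at h
    rwa [← mulVec_mulVec, dotProduct_mulVec v (M ^ k), ← mulVec_transpose]
  have hN : (0 : ℝ) < (N : ℝ) + 1 := by positivity
  simp only [cesaroGram, smul_mulVec, sum_mulVec, dotProduct_smul, dotProduct_sum, smul_eq_mul]
  rw [mul_left_comm, le_inv_mul_iff₀ hN, Finset.mul_sum]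
  refine le_trans ?_ (Finset.sum_le_sum fun k _ => hk k)
  simp

open Matrix Filter Topology in
-- The averages lie in a compact box. A limit point along a subsequence suffices: the failure of
-- invariance is `O(1/N)`, and the lower bound on the averages makes the limit definite.
theorem exists_posDef_of_pow_bounded {M : Matrix (l ⊕ l) (l ⊕ l) ℝ}
    (hM : M ∈ symplecticGroup l ℝ) {C : ℝ} (hC : ∀ (k : ℕ) i j, |(M ^ k) i j| ≤ C) :
    ∃ H : Matrix (l ⊕ l) (l ⊕ l) ℝ, H.PosDef ∧ M * H * Mᵀ = H := by
  set C' : ℝ := Fintype.card (l ⊕ l) * (C * C) with hC'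
  have hcpt : IsCompact (Set.univ.pi fun _ : l ⊕ l => Set.univ.pi fun _ : l ⊕ l =>
      Set.Icc (-C') C') := isCompact_univ_pi fun _ => isCompact_univ_pi fun _ => isCompact_Icc
  obtain ⟨H, φ, hφ, hlim⟩ : ∃ (H : Matrix (l ⊕ l) (l ⊕ l) ℝ) (φ : ℕ → ℕ), StrictMono φ ∧
      Tendsto (fun k => cesaroGram M (φ k)) atTop (𝓝 H) := by
    obtain ⟨H, -, φ, hφ, hlim⟩ := hcpt.tendsto_subseq (X := l ⊕ l → l ⊕ l → ℝ)
      (x := fun N => cesaroGram M N)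
      fun N i _ j _ => abs_le.1 (abs_cesaroGram_apply_le hC N i j)
    exact ⟨H, φ, hφ, hlim⟩
  have hinv : Tendsto (fun k => ((φ k : ℝ) + 1)⁻¹) atTop (𝓝 0) :=
    (tendsto_inv_atTop_zero.comp (tendsto_atTop_add_const_right _ _
      tendsto_natCast_atTop_atTop)).comp hφ.tendsto_atTop
  have hrem : Tendsto (fun k => ((φ k : ℝ) + 1)⁻¹ •
      (M ^ (φ k + 1) * (M ^ (φ k + 1))ᵀ - 1)) atTop (𝓝 (0 : Matrix (l ⊕ l) (l ⊕ l) ℝ)) := by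
    refine tendsto_pi_nhds.2 fun i => tendsto_pi_nhds.2 fun j => ?_
    refine squeeze_zero_norm (a := fun k => ((φ k : ℝ) + 1)⁻¹ * (C' + 1)) (fun k => ?_)
      (by simpa using hinv.mul_const (C' + 1))
    simp only [Matrix.smul_apply, Matrix.sub_apply, smul_eq_mul, norm_mul, Real.norm_eq_abs]
    rw [abs_of_pos (by positivity : (0 : ℝ) < ((φ k : ℝ) + 1)⁻¹)]
    refine mul_le_mul_of_nonneg_left ((abs_sub _ _).trans (add_le_add
      (abs_mul_transpose_apply_le (hC _) i j) ?_)) (by positivity)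
    rw [one_apply]
    split_ifs <;> simp
  refine ⟨H, PosDef.of_dotProduct_mulVec_pos ?_ fun v hv => ?_, ?_⟩
  · have h : ∀ N, (cesaroGram M N)ᵀ = cesaroGram M N := fun N => by
      simp [cesaroGram, transpose_sum, transpose_mul]
    have h1 : Tendsto (fun k => (cesaroGram M (φ k))ᵀ) atTop (𝓝 Hᵀ) :=
      (continuous_id.matrix_transpose.tendsto _).comp hlim
    simp only [h] at h1
    simpa [IsHermitian] using tendsto_nhds_unique h1 hlim
  · have hlow : v ⬝ᵥ v ≤ (Fintype.card (l ⊕ l) * (Fintype.card (l ⊕ l) * C ^ 2)) *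
        (v ⬝ᵥ (H *ᵥ v)) := by
      refine ge_of_tendsto' (x := atTop)
        (f := fun k => (Fintype.card (l ⊕ l) * (Fintype.card (l ⊕ l) * C ^ 2)) *
          (v ⬝ᵥ (cesaroGram M (φ k) *ᵥ v))) ?_
        fun k => le_dotProduct_cesaroGram_mulVec hM hC (φ k) v
      have hcont : Continuous fun A : Matrix (l ⊕ l) (l ⊕ l) ℝ => v ⬝ᵥ (A *ᵥ v) :=
        continuous_const.dotProduct (continuous_id.matrix_mulVec continuous_const)
      exact ((hcont.tendsto _).comp hlim).const_mul _
    have hpos : 0 < v ⬝ᵥ v := by simpa using dotProduct_self_star_pos_iff.2 hv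
    have := pos_of_mul_pos_right (hpos.trans_le hlow) (by positivity)
    simpa using this
  · have hcont : Continuous fun A : Matrix (l ⊕ l) (l ⊕ l) ℝ => M * A * Mᵀ := by fun_prop
    have h1 := (hcont.tendsto _).comp hlim
    have h2 := hlim.add hrem
    simp only [Function.comp_def, mul_cesaroGram_mul] at h1
    rw [add_zero] at h2
    exact tendsto_nhds_unique h1 h2

end SymplecticNormalForm

/-! ### The Hamiltonian flow: symplecticity, Floquet relation, observability from the position -/

section Flow

variable {n : ℕ} {κ R m : ℝ → Mat n}

open Matrix in
theorem stdJ_mul_hamMatrix (k r μ : Mat n) :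
    stdJ n * hamMatrix k r μ = fromBlocks rᵀ μ⁻¹ (-k) (-r) := by
  simp [stdJ, hamMatrix, fromBlocks_multiply]

open Matrix in
theorem continuous_matrix_inv {X ι : Type*} [TopologicalSpace X] [Fintype ι] [DecidableEq ι]
    {f : X → Matrix ι ι ℝ} (hf : Continuous f) (hu : ∀ x, IsUnit (f x).det) :
    Continuous fun x => (f x)⁻¹ := by
  simp only [inv_def, Ring.inverse_eq_inv']
  exact (hf.matrix_det.inv₀ fun x => (hu x).ne_zero).smul hf.matrix_adjugate

open Matrix in
theorem continuous_hamGen (hκc : Continuous κ) (hRc : Continuous R) (hmc : Continuous m)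
    (hm : ∀ t, IsUnit (m t).det) :
    Continuous fun t => stdJ n * hamMatrix (κ t) (R t) (m t) := by
  simp only [stdJ_mul_hamMatrix]
  exact hRc.matrix_transpose.matrix_fromBlocks (continuous_matrix_inv hmc hm) hκc.neg hRc.neg

open Matrix in
-- Infinitesimal symplecticity: it makes the constant `J` a solution of the Lyapunov equation
-- satisfied by `Φ * J * Φᵀ`, so uniqueness yields that the flow is symplectic.
theorem hamGen_mul_J_add {k r μ : Mat n} (hk : k.IsSymm) (hμ : μ.IsSymm) :
    (stdJ n * hamMatrix k r μ) * J (Fin n) ℝ +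
      J (Fin n) ℝ * (stdJ n * hamMatrix k r μ)ᵀ = 0 := by
  have h1 : (μ⁻¹)ᵀ = μ⁻¹ := by rw [transpose_nonsing_inv, hμ.eq]
  rw [stdJ_mul_hamMatrix, J, fromBlocks_transpose, fromBlocks_multiply, fromBlocks_multiply,
    fromBlocks_add]
  simp [hk.eq, h1]

open Matrix in
theorem exists_hamFlow (hκc : Continuous κ) (hRc : Continuous R) (hmc : Continuous m)
    (hm : ∀ t, IsUnit (m t).det) :
    ∃ Φ : ℝ → Matrix (Fin n ⊕ Fin n) (Fin n ⊕ Fin n) ℝ, Φ 0 = 1 ∧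
      ∀ t, HasDerivAt Φ ((stdJ n * hamMatrix (κ t) (R t) (m t)) * Φ t) t :=
  exists_hasDerivAt_matrix_mul (continuous_hamGen hκc hRc hmc hm) 1

variable {Φ : ℝ → Matrix (Fin n ⊕ Fin n) (Fin n ⊕ Fin n) ℝ}

open Matrix in
theorem hamFlow_mul_mul_transpose_hasDerivAt
    (hΦ : ∀ t, HasDerivAt Φ ((stdJ n * hamMatrix (κ t) (R t) (m t)) * Φ t) t)
    (H : Matrix (Fin n ⊕ Fin n) (Fin n ⊕ Fin n) ℝ) (t : ℝ) :
    HasDerivAt (fun t => Φ t * H * (Φ t)ᵀ)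
      ((stdJ n * hamMatrix (κ t) (R t) (m t)) * (Φ t * H * (Φ t)ᵀ) +
        (Φ t * H * (Φ t)ᵀ) * (stdJ n * hamMatrix (κ t) (R t) (m t))ᵀ) t := by
  have hH : HasDerivAt (fun _ : ℝ => H) 0 t := by
    rw [hasDerivAt_matrix_iff]
    exact fun i j => hasDerivAt_const _ _
  have h := ((hΦ t).matrix_mul hH).matrix_mul (hΦ t).matrix_transpose
  have e : (stdJ n * hamMatrix (κ t) (R t) (m t) * Φ t * H + Φ t * 0) * (Φ t)ᵀ +
      Φ t * H * (stdJ n * hamMatrix (κ t) (R t) (m t) * Φ t)ᵀ =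
      ((stdJ n * hamMatrix (κ t) (R t) (m t)) * (Φ t * H * (Φ t)ᵀ) +
        (Φ t * H * (Φ t)ᵀ) * (stdJ n * hamMatrix (κ t) (R t) (m t))ᵀ) := by
    rw [transpose_mul _ (Φ t)]
    noncomm_ring
  rwa [e] at h

open Matrix in
theorem hamFlow_mem_symplecticGroup (hκc : Continuous κ) (hRc : Continuous R) (hmc : Continuous m)
    (hκs : ∀ t, (κ t).IsSymm) (hms : ∀ t, (m t).IsSymm) (hm : ∀ t, IsUnit (m t).det)
    (h0 : Φ 0 = 1) (hΦ : ∀ t, HasDerivAt Φ ((stdJ n * hamMatrix (κ t) (R t) (m t)) * Φ t) t)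
    (t : ℝ) : Φ t ∈ symplecticGroup (Fin n) ℝ := by
  have hB := continuous_hamGen hκc hRc hmc hm
  rw [SymplecticGroup.mem_iff]
  refine congrFun (matrix_eq_of_hasDerivAt hB hB.matrix_transpose
    (hamFlow_mul_mul_transpose_hasDerivAt hΦ (J (Fin n) ℝ)) (Y := fun _ => J (Fin n) ℝ)
    (fun s => ?_) (t₀ := 0) (by simp [h0])) t
  rw [hamGen_mul_J_add (hκs s) (hms s), hasDerivAt_matrix_iff]
  exact fun i j => hasDerivAt_const _ _

open Matrix in
theorem hamFlow_add {T : ℝ} (hκc : Continuous κ) (hRc : Continuous R) (hmc : Continuous m)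
    (hκT : Function.Periodic κ T) (hRT : Function.Periodic R T) (hmT : Function.Periodic m T)
    (hm : ∀ t, IsUnit (m t).det)
    (h0 : Φ 0 = 1) (hΦ : ∀ t, HasDerivAt Φ ((stdJ n * hamMatrix (κ t) (R t) (m t)) * Φ t) t)
    (t : ℝ) : Φ (t + T) = Φ t * Φ T := by
  refine congrFun (matrix_eq_of_hasDerivAt_left (continuous_hamGen hκc hRc hmc hm)
    (X := fun t => Φ (t + T)) (Y := fun t => Φ t * Φ T) (fun s => ?_) (fun s => ?_)
    (t₀ := 0) (by simp [h0])) t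
  · have h := hΦ (s + T)
    rw [hκT, hRT, hmT] at h
    rw [hasDerivAt_matrix_iff] at h ⊢
    exact fun i j => (h i j).comp_add_const s T
  · have hT : HasDerivAt (fun _ : ℝ => Φ T) 0 s := by
      rw [hasDerivAt_matrix_iff]
      exact fun i j => hasDerivAt_const _ _
    have h := (hΦ s).matrix_mul hT
    rwa [mul_zero, add_zero, mul_assoc] at h

open Matrix in
theorem hamFlow_mulVec_isHamSolution
    (hΦ : ∀ t, HasDerivAt Φ ((stdJ n * hamMatrix (κ t) (R t) (m t)) * Φ t) t) (z₀ : Phase n) :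
    IsHamSolution κ R m fun t => Φ t *ᵥ z₀ := by
  intro t
  have h := (hΦ t).matrix_mulVec (hasDerivAt_const t z₀)
  rwa [mulVec_zero, add_zero, ← mulVec_mulVec] at h

open Matrix in
theorem IsHamSolution.eq_hamFlow_mulVec (hκc : Continuous κ) (hRc : Continuous R)
    (hmc : Continuous m) (hm : ∀ t, IsUnit (m t).det) (h0 : Φ 0 = 1)
    (hΦ : ∀ t, HasDerivAt Φ ((stdJ n * hamMatrix (κ t) (R t) (m t)) * Φ t) t)
    {z : ℝ → Phase n} (hz : IsHamSolution κ R m z) (t : ℝ) : z t = Φ t *ᵥ z 0 :=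
  congrFun (mulVec_eq_of_hasDerivAt (continuous_hamGen hκc hRc hmc hm) hz
    (hamFlow_mulVec_isHamSolution hΦ (z 0)) (t₀ := 0) (by simp [h0])) t

theorem IsHamSolution.comp_add_zsmul {T : ℝ} (hκT : Function.Periodic κ T)
    (hRT : Function.Periodic R T) (hmT : Function.Periodic m T)
    {z : ℝ → Phase n} (hz : IsHamSolution κ R m z) (k : ℤ) :
    IsHamSolution κ R m fun t => z (t + k • T) := by
  intro t
  have h := hz (t + k • T)
  rw [hκT.zsmul k, hRT.zsmul k, hmT.zsmul k] at h
  exact h.comp_add_const t _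

open Matrix in
theorem IsHamSolution.hasDerivAt_position {z : ℝ → Phase n} (hz : IsHamSolution κ R m z) (t : ℝ) :
    HasDerivAt (fun t => z t ∘ Sum.inl)
      ((R t)ᵀ *ᵥ (z t ∘ Sum.inl) + (m t)⁻¹ *ᵥ (z t ∘ Sum.inr)) t := by
  have h := hz t
  rw [stdJ_mul_hamMatrix, fromBlocks_mulVec, hasDerivAt_pi] at h
  exact hasDerivAt_pi.2 fun i => h (Sum.inl i)

open Matrix in
theorem IsHamSolution.hasDerivAt_momentum {z : ℝ → Phase n} (hz : IsHamSolution κ R m z) (t : ℝ) :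
    HasDerivAt (fun t => z t ∘ Sum.inr)
      (-κ t *ᵥ (z t ∘ Sum.inl) + -R t *ᵥ (z t ∘ Sum.inr)) t := by
  have h := hz t
  rw [stdJ_mul_hamMatrix, fromBlocks_mulVec, hasDerivAt_pi] at h
  exact hasDerivAt_pi.2 fun i => h (Sum.inr i)

open Matrix in
-- If `x` vanishes near a point then so does `ẋ = Rᵀ x + m⁻¹ p`, which forces `p = 0` there;
-- uniqueness does the rest.
theorem IsHamSolution.eq_zero_of_position_eq_zero (hκc : Continuous κ) (hRc : Continuous R)
    (hmc : Continuous m) (hm : ∀ t, IsUnit (m t).det) {z : ℝ → Phase n}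
    (hz : IsHamSolution κ R m z) {a b : ℝ} (hab : a < b)
    (hx : ∀ t ∈ Set.Icc a b, z t ∘ Sum.inl = 0) : z = 0 := by
  have hmem : (a + b) / 2 ∈ Set.Ioo a b := ⟨by linarith, by linarith⟩
  have h1 := hz.hasDerivAt_position ((a + b) / 2)
  have h2 : HasDerivAt (fun t => z t ∘ Sum.inl) 0 ((a + b) / 2) := by
    refine (hasDerivAt_const _ (0 : Fin n → ℝ)).congr_of_eventuallyEq ?_
    filter_upwards [isOpen_Ioo.mem_nhds hmem] with t ht
    exact hx t ⟨ht.1.le, ht.2.le⟩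
  have hx0 := hx _ ⟨hmem.1.le, hmem.2.le⟩
  have h3 := h1.unique h2
  rw [hx0, mulVec_zero, zero_add] at h3
  have hp0 : z ((a + b) / 2) ∘ Sum.inr = 0 := by
    have := congrArg (m ((a + b) / 2) *ᵥ ·) h3
    simpa [mulVec_mulVec, mul_nonsing_inv _ (hm _)] using this
  have hz0 : z ((a + b) / 2) = 0 := by
    funext i
    rcases i with i | i
    · exact congrFun hx0 i
    · exact congrFun hp0 i
  exact mulVec_eq_of_hasDerivAt (continuous_hamGen hκc hRc hmc hm) hz (y := 0)
    (fun t => by simp) hz0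

attribute [local instance] Matrix.linftyOpNormedRing Matrix.linftyOpNormedAlgebra in
open Matrix in
-- Quantitative observability: the map from initial values to position curves on `[0, T]` is linear
-- and injective on a finite-dimensional space, hence bounded below.
theorem exists_norm_le_of_norm_position_le {T : ℝ} (hT : 0 < T) (hκc : Continuous κ)
    (hRc : Continuous R) (hmc : Continuous m) (hm : ∀ t, IsUnit (m t).det) :
    ∃ c : ℝ, ∀ z : ℝ → Phase n, IsHamSolution κ R m z → ∀ C : ℝ, 0 ≤ C →
      (∀ t ∈ Set.Icc 0 T, ‖z t ∘ Sum.inl‖ ≤ C) → ∀ t ∈ Set.Icc 0 T, ‖z t‖ ≤ c * C := by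
  obtain ⟨Φ, h0, hΦ⟩ := exists_hamFlow hκc hRc hmc hm
  have hΦc : Continuous Φ := continuous_of_matrix_hasDerivAt hΦ
  let obs : Phase n →ₗ[ℝ] C(Set.Icc 0 T, Fin n → ℝ) :=
    { toFun := fun z₀ => ⟨fun t => (Φ t *ᵥ z₀) ∘ Sum.inl, by
        refine continuous_pi fun i => ?_
        exact (continuous_apply (Sum.inl i)).comp
          ((hΦc.comp continuous_subtype_val).matrix_mulVec continuous_const)⟩
      map_add' := fun u v => by ext t i; simp [mulVec_add]
      map_smul' := fun c u => by ext t i; simp [mulVec_smul] }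
  have hker : LinearMap.ker obs = ⊥ := by
    rw [LinearMap.ker_eq_bot']
    intro z₀ hz₀
    have hsol := (hamFlow_mulVec_isHamSolution hΦ z₀).eq_zero_of_position_eq_zero hκc hRc hmc hm hT
      fun t ht => congrArg (fun f : C(Set.Icc 0 T, Fin n → ℝ) => f ⟨t, ht⟩) hz₀
    simpa [h0] using congrFun hsol 0
  obtain ⟨K, -, hK⟩ := obs.exists_antilipschitzWith hker
  obtain ⟨N, hN⟩ := (isCompact_Icc (a := (0 : ℝ)) (b := T)).bddAbove_image hΦc.norm.continuousOn
  refine ⟨N * K, fun z hz C hC hx t ht => ?_⟩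
  have hzΦ := hz.eq_hamFlow_mulVec hκc hRc hmc hm h0 hΦ
  have h1 : ‖obs (z 0)‖ ≤ C := by
    refine (ContinuousMap.norm_le _ hC).2 fun s => ?_
    change ‖(Φ s *ᵥ z 0) ∘ Sum.inl‖ ≤ C
    rw [← hzΦ]
    exact hx s s.2
  have h2 : ‖z 0‖ ≤ K * C := (ZeroHomClass.bound_of_antilipschitz obs hK (z 0)).trans
    (mul_le_mul_of_nonneg_left h1 K.2)
  rw [hzΦ t, mul_assoc]
  exact (linfty_opNorm_mulVec _ _).trans (mul_le_mul (hN ⟨t, ht, rfl⟩) h2 (norm_nonneg _)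
    ((norm_nonneg _).trans (hN ⟨t, ht, rfl⟩)))

/-- Translation by multiples of the period carries solutions to solutions, so the constant found on
`[0, T]` serves every window. -/
theorem IsHamSolution.bounded_of_position_bounded {T : ℝ} (hT : 0 < T)
    (hκc : Continuous κ) (hRc : Continuous R) (hmc : Continuous m)
    (hκT : Function.Periodic κ T) (hRT : Function.Periodic R T) (hmT : Function.Periodic m T)
    (hm : ∀ t, IsUnit (m t).det) {z : ℝ → Phase n} (hz : IsHamSolution κ R m z) {C : ℝ}
    (hC : ∀ t, ‖z t ∘ Sum.inl‖ ≤ C) : ∃ C' : ℝ, ∀ t, ‖z t‖ ≤ C' := by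
  obtain ⟨c, hc⟩ := exists_norm_le_of_norm_position_le hT hκc hRc hmc hm
  refine ⟨c * C, fun t => ?_⟩
  obtain ⟨k, hk, -⟩ := existsUnique_sub_zsmul_mem_Ico hT t 0
  rw [zero_add] at hk
  have := hc _ (hz.comp_add_zsmul hκT hRT hmT k) C ((norm_nonneg _).trans (hC 0))
    (fun s _ => hC _) (t - k • T) ⟨hk.1, hk.2.le⟩
  simpa using this

end Flow

/-! ### From a periodic symplectic covariance to an envelope matrix -/

section Construction

variable {n : ℕ} {κ R m : ℝ → Mat n}

open Matrix in
/-- `a`, `b`, `d` are the blocks of a symmetric symplectic matrix `F` evolving by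
`Ḟ = J A F + F (J A)ᵀ`. -/
theorem exists_envelope_of_covariance (hRc : Continuous R) (hmc : Continuous m)
    (hms : ∀ t, (m t).IsSymm) (hm : ∀ t, IsUnit (m t).det) {a b d : ℝ → Mat n}
    (ha : ∀ t, (a t).PosDef) (hba : ∀ t, b t * a t = a t * (b t)ᵀ)
    (had : ∀ t, a t * d t - b t * b t = 1)
    (ha' : ∀ t, HasDerivAt a
      ((R t)ᵀ * a t + (m t)⁻¹ * (b t)ᵀ + (a t * R t + b t * (m t)⁻¹)) t)
    (hb' : ∀ t, HasDerivAt b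
      ((R t)ᵀ * b t + (m t)⁻¹ * d t + (a t * -κ t + b t * -(R t)ᵀ)) t) :
    ∃ w : ℝ → Mat n, IsEnvelopeSolution κ R m w ∧
      envelopeS R m w 0 ∈ symplecticGroup (Fin n) ℝ ∧ ∀ t, (w t)ᵀ * w t = a t := by
  have hau : ∀ t, IsUnit (a t).det := fun t => (isUnit_iff_isUnit_det _).1 (ha t).isUnit
  have hat : ∀ t, (a t)ᵀ = a t := fun t => by simpa using (ha t).isHermitian.eq
  have haa : ∀ t, a t * (a t)⁻¹ = 1 := fun t => mul_nonsing_inv _ (hau t)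
  have haa' : ∀ t, (a t)⁻¹ * a t = 1 := fun t => nonsing_inv_mul _ (hau t)
  have hmm : ∀ t, m t * (m t)⁻¹ = 1 := fun t => mul_nonsing_inv _ (hm t)
  have hmm' : ∀ t, (m t)⁻¹ * m t = 1 := fun t => nonsing_inv_mul _ (hm t)
  have hmit : ∀ t, ((m t)⁻¹)ᵀ = (m t)⁻¹ := fun t => by rw [transpose_nonsing_inv, (hms t).eq]
  have hsymm : ∀ t, (a t)⁻¹ * b t = (b t)ᵀ * (a t)⁻¹ := fun t => by
    calc (a t)⁻¹ * b t = (a t)⁻¹ * (b t * a t) * (a t)⁻¹ := by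
          rw [mul_assoc, mul_assoc, haa, mul_one]
      _ = ((a t)⁻¹ * a t) * (b t)ᵀ * (a t)⁻¹ := by rw [hba]; noncomm_ring
      _ = _ := by rw [haa', one_mul]
  -- `ẇ = w L` with this `L` does two things at once: `a L` plus its transpose is `ȧ`, so `wᵀ w`
  -- follows `a`, and the momentum `ẇ m - w R m` equals `w a⁻¹ b = (wᵀ)⁻¹ b`.
  obtain ⟨L, hL⟩ : ∃ L : ℝ → Mat n, ∀ t, L t = R t + (a t)⁻¹ * b t * (m t)⁻¹ :=
    ⟨_, fun _ => rfl⟩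
  have hLc : Continuous L := by
    have h1 := continuous_matrix_inv (continuous_of_matrix_hasDerivAt ha') hau
    have h2 := continuous_matrix_inv hmc hm
    have h3 := continuous_of_matrix_hasDerivAt hb'
    rw [funext hL]
    exact hRc.add ((h1.matrix_mul h3).matrix_mul h2)
  have haL : ∀ t, a t * L t = a t * R t + b t * (m t)⁻¹ := fun t => by
    rw [hL, mul_add, ← mul_assoc, ← mul_assoc, haa, one_mul]
  have hLa : ∀ t, (L t)ᵀ * a t = (R t)ᵀ * a t + (m t)⁻¹ * (b t)ᵀ := fun t => by
    have := congrArg transpose (haL t)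
    simpa [transpose_mul, hat, hmit] using this
  -- Existence is available for multiplication from the left, so the transpose of `w` is
  -- constructed. It starts at the symmetric root of `a 0`, which gives `wᵀ w = a` at time `0`.
  obtain ⟨X, hX0, hX⟩ := exists_hasDerivAt_matrix_mul hLc.matrix_transpose (CFC.sqrt (a 0))
  obtain ⟨w, hw⟩ : ∃ w : ℝ → Mat n, w = fun t => (X t)ᵀ := ⟨_, rfl⟩
  have hw' : ∀ t, HasDerivAt w (w t * L t) t := fun t => by
    simpa [hw, transpose_mul] using (hX t).matrix_transpose
  have hwt' : ∀ t, HasDerivAt (fun s => (w s)ᵀ) ((L t)ᵀ * (w t)ᵀ) t := fun t => by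
    simpa [transpose_mul] using (hw' t).matrix_transpose
  have hwa : ∀ t, (w t)ᵀ * w t = a t := by
    refine fun t => congrFun (matrix_eq_of_hasDerivAt hLc.matrix_transpose hLc
      (X := fun t => (w t)ᵀ * w t) (fun s => ?_) (fun s => ?_) (t₀ := 0) ?_) t
    · simpa only [mul_assoc] using (hwt' s).matrix_mul (hw' s)
    · rw [hLa, haL]
      exact ha' s
    · have hs : (CFC.sqrt (a 0))ᵀ = CFC.sqrt (a 0) := by
        simpa using (CFC.sqrt_nonneg (a 0)).posSemidef.isHermitian.eq
      simp only [hw, hX0, hs]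
      exact CFC.sqrt_mul_sqrt_self _ (ha 0).posSemidef.nonneg
  have hwu : ∀ t, IsUnit (w t).det := fun t => by
    have := hau t
    rw [← hwa, det_mul] at this
    exact isUnit_of_mul_isUnit_right this
  have hwtu : ∀ t, IsUnit ((w t)ᵀ).det := fun t => by rw [det_transpose]; exact hwu t
  have hwi : ∀ t, (w t)ᵀ * ((w t)ᵀ)⁻¹ = 1 := fun t => mul_nonsing_inv _ (hwtu t)
  have hwi' : ∀ t, ((w t)ᵀ)⁻¹ * (w t)ᵀ = 1 := fun t => nonsing_inv_mul _ (hwtu t)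
  have hwai : ∀ t, w t * (a t)⁻¹ = ((w t)ᵀ)⁻¹ := fun t => by
    calc w t * (a t)⁻¹ = (((w t)ᵀ)⁻¹ * (w t)ᵀ) * w t * (a t)⁻¹ := by rw [hwi', one_mul]
      _ = ((w t)ᵀ)⁻¹ * (((w t)ᵀ * w t) * (a t)⁻¹) := by noncomm_ring
      _ = _ := by rw [hwa, haa, mul_one]
  have hwd : ∀ t, deriv w t = w t * L t := fun t => (hw' t).matrix_deriv
  have hP : (fun s => deriv w s * m s - w s * R s * m s) = fun s => ((w s)ᵀ)⁻¹ * b s := by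
    funext s
    rw [hwd, hL]
    calc w s * (R s + (a s)⁻¹ * b s * (m s)⁻¹) * m s - w s * R s * m s
        = (w s * (a s)⁻¹) * b s * ((m s)⁻¹ * m s) := by noncomm_ring
      _ = _ := by rw [hmm', hwai, mul_one]
  have hP' : ∀ t, HasDerivAt (fun s => ((w s)ᵀ)⁻¹ * b s)
      (((w t)ᵀ)⁻¹ * (((R t)ᵀ * b t + (m t)⁻¹ * d t + (a t * -κ t + b t * -(R t)ᵀ)) -
        (L t)ᵀ * b t)) t := fun t => by
    have h := ((hwt' t).matrix_inv (hwtu t)).matrix_mul (hb' t)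
    have e : -(((w t)ᵀ)⁻¹ * ((L t)ᵀ * (w t)ᵀ) * ((w t)ᵀ)⁻¹) = -(((w t)ᵀ)⁻¹ * (L t)ᵀ) := by
      rw [mul_assoc, mul_assoc (L t)ᵀ, hwi, mul_one]
    rw [e] at h
    rw [mul_sub, sub_eq_neg_add, ← mul_assoc, ← neg_mul]
    exact h
  refine ⟨w, ⟨hwu, differentiable_of_matrix_hasDerivAt hw', ?_, fun t => ?_⟩, ?_, hwa⟩
  · rw [hP]
    exact differentiable_of_matrix_hasDerivAt hP'
  · rw [hP, (hP' t).matrix_deriv, hwd, hwa]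
    have hinv : (a t * m t * (w t)ᵀ)⁻¹ = ((w t)ᵀ)⁻¹ * (m t)⁻¹ * (a t)⁻¹ := by
      rw [Matrix.mul_inv_rev, Matrix.mul_inv_rev, mul_assoc]
    -- The Schur complement `d - bᵀ a⁻¹ b` equals `a⁻¹` by the symplectic relations. This is the
    -- source of the nonlinear term of the envelope equation.
    have hd : (m t)⁻¹ * d t - (m t)⁻¹ * (b t)ᵀ * (a t)⁻¹ * b t - (m t)⁻¹ * (a t)⁻¹ = 0 := by
      calc (m t)⁻¹ * d t - (m t)⁻¹ * (b t)ᵀ * (a t)⁻¹ * b t - (m t)⁻¹ * (a t)⁻¹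
          = (m t)⁻¹ * (d t - ((b t)ᵀ * (a t)⁻¹) * b t - (a t)⁻¹) := by noncomm_ring
        _ = (m t)⁻¹ * (((a t)⁻¹ * a t) * d t - (a t)⁻¹ * b t * b t - (a t)⁻¹) := by
            rw [← hsymm, haa', one_mul]
        _ = (m t)⁻¹ * ((a t)⁻¹ * (a t * d t - b t * b t) - (a t)⁻¹) := by noncomm_ring
        _ = 0 := by rw [had]; simp
    have hLt : (L t)ᵀ = (R t)ᵀ + (m t)⁻¹ * (b t)ᵀ * (a t)⁻¹ := by
      rw [hL]
      simp only [transpose_add, transpose_mul, hmit, transpose_nonsing_inv, hat]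
      noncomm_ring
    have hwLm : w t * L t * m t = w t * R t * m t + ((w t)ᵀ)⁻¹ * b t := by
      have := congrFun hP t
      simp only [hwd] at this
      rw [← this]; abel
    have hwa' : w t = ((w t)ᵀ)⁻¹ * a t := by rw [← hwa, ← mul_assoc, hwi', one_mul]
    rw [hinv, hLt, hwLm]
    calc _ = ((w t)ᵀ)⁻¹ * ((m t)⁻¹ * d t - (m t)⁻¹ * (b t)ᵀ * (a t)⁻¹ * b t - (m t)⁻¹ * (a t)⁻¹)
            + (w t - ((w t)ᵀ)⁻¹ * a t) * κ t := by noncomm_ring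
      _ = 0 := by rw [hd, ← hwa']; simp
  · have hC : (w 0 * R 0 - deriv w 0) * m 0 = -(((w 0)ᵀ)⁻¹ * b 0) := by
      have := congrFun hP 0
      rw [← this, sub_mul]; abel
    rw [envelopeS, hC, SymplecticGroup.fromBlocks_mem_iff]
    have hai : ((w 0)⁻¹) * ((w 0)ᵀ)⁻¹ = (a 0)⁻¹ := by rw [← hwa, Matrix.mul_inv_rev]
    have hwtt : (((w 0)ᵀ)⁻¹)ᵀ = (w 0)⁻¹ := by rw [transpose_nonsing_inv, transpose_transpose]
    refine ⟨?_, by simp, ?_⟩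
    · rw [transpose_neg, transpose_mul, hwtt, mul_neg, neg_mul, ← mul_assoc, hai, mul_assoc, hai,
        hsymm]
    · rw [hwtt, mul_zero, sub_zero, nonsing_inv_mul _ (hwu 0)]

end Construction

/-! ### Stability implies existence of the envelope matrix -/

section Necessity

variable {n : ℕ} {κ R m : ℝ → Mat n}

open Matrix in
theorem hasDerivAt_toBlocks {ι : Type*} [Fintype ι] {F : ℝ → Matrix (ι ⊕ ι) (ι ⊕ ι) ℝ}
    {A B C D : Matrix ι ι ℝ} {t : ℝ} (hF : HasDerivAt F (fromBlocks A B C D) t) :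
    HasDerivAt (fun s => (F s).toBlocks₁₁) A t ∧ HasDerivAt (fun s => (F s).toBlocks₁₂) B t := by
  simp only [hasDerivAt_matrix_iff] at hF ⊢
  exact ⟨fun i j => hF (Sum.inl i) (Sum.inl j), fun i j => hF (Sum.inl i) (Sum.inr j)⟩

open Matrix in
theorem exists_envelope_of_isStable {T : ℝ} (hT : 0 < T)
    (hκc : Continuous κ) (hRc : Continuous R) (hmc : Continuous m)
    (hκT : Function.Periodic κ T) (hRT : Function.Periodic R T) (hmT : Function.Periodic m T)
    (hκs : ∀ t, (κ t).IsSymm) (hms : ∀ t, (m t).IsSymm) (hm : ∀ t, IsUnit (m t).det)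
    (hst : IsStable κ R m) :
    ∃ w : ℝ → Mat n, IsEnvelopeSolution κ R m w ∧
      envelopeS R m w 0 ∈ symplecticGroup (Fin n) ℝ ∧
      Function.Periodic (fun t => matAbs (w t)) T := by
  obtain ⟨Φ, h0, hΦ⟩ := exists_hamFlow hκc hRc hmc hm
  have hsymp := hamFlow_mem_symplecticGroup hκc hRc hmc hκs hms hm h0 hΦ
  have hadd := hamFlow_add hκc hRc hmc hκT hRT hmT hm h0 hΦ
  have hpow : ∀ k : ℕ, Φ (k * T) = Φ T ^ k := by
    intro k
    induction k with
    | zero => simp [h0]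
    | succ k ih => rw [Nat.cast_succ, add_mul, one_mul, hadd, ih, pow_succ]
  -- The columns of `Φ` are solutions issued from basis vectors; sampling their bounds at the times
  -- `k * T` bounds the entries of `Φ T ^ k`.
  obtain ⟨C, hC⟩ : ∃ C : ℝ, ∀ (k : ℕ) i j, |(Φ T ^ k) i j| ≤ C := by
    choose c hc using fun j : Fin n ⊕ Fin n =>
      hst _ (hamFlow_mulVec_isHamSolution hΦ (Pi.single j 1))
    refine ⟨∑ j, |c j|, fun k i j => ?_⟩
    have h1 := (norm_le_pi_norm _ i).trans (hc j (k * T) (by positivity))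
    rw [hpow, mulVec_single_one, Real.norm_eq_abs] at h1
    exact (h1.trans (le_abs_self _)).trans
      (Finset.single_le_sum (f := fun j => |c j|) (fun j _ => abs_nonneg _) (Finset.mem_univ j))
  obtain ⟨H₀, hH₀, hinv₀⟩ := exists_posDef_of_pow_bounded (hsymp T) hC
  obtain ⟨H, hH, hinv, hHs⟩ := exists_posDef_mem_symplecticGroup (hsymp T) hH₀ hinv₀
  obtain ⟨F, hF⟩ : ∃ F : ℝ → Matrix (Fin n ⊕ Fin n) (Fin n ⊕ Fin n) ℝ,
      F = fun t => Φ t * H * (Φ t)ᵀ := ⟨_, rfl⟩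
  have hFpos : ∀ t, (F t).PosDef := fun t => by
    have hu : IsUnit (F t) := by
      have h1 := SymplecticGroup.symplectic_det (hsymp t)
      rw [isUnit_iff_isUnit_det, hF, det_mul, det_mul, det_transpose]
      exact (h1.mul ((isUnit_iff_isUnit_det _).1 hH.isUnit)).mul h1
    refine PosSemidef.posDef_iff_isUnit ?_ |>.2 hu
    rw [hF]
    simpa using hH.posSemidef.mul_mul_conjTranspose_same (Φ t)
  have hFs : ∀ t, F t ∈ symplecticGroup (Fin n) ℝ := fun t => by
    rw [hF]
    exact mul_mem (mul_mem (hsymp t) hHs) (SymplecticGroup.transpose_mem (hsymp t))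
  have hFT : ∀ t, F (t + T) = F t := fun t => by
    simp only [hF, hadd, transpose_mul]
    calc Φ t * Φ T * H * ((Φ T)ᵀ * (Φ t)ᵀ) = Φ t * (Φ T * H * (Φ T)ᵀ) * (Φ t)ᵀ := by noncomm_ring
      _ = _ := by rw [hinv]
  have hFt : ∀ t, (F t)ᵀ = F t := fun t => by simpa using (hFpos t).isHermitian.eq
  have h21 : ∀ t, (F t).toBlocks₂₁ = ((F t).toBlocks₁₂)ᵀ := fun t => by
    conv_lhs => rw [← hFt t]
    rfl
  have h11 : ∀ t, ((F t).toBlocks₁₁)ᵀ = (F t).toBlocks₁₁ := fun t => by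
    conv_rhs => rw [← hFt t]
    rfl
  have hF' : ∀ t, HasDerivAt F _ t := hF ▸ hamFlow_mul_mul_transpose_hasDerivAt hΦ H
  have hder := fun t => by
    have h := hF' t
    rw [show Φ t * H * (Φ t)ᵀ = fromBlocks (F t).toBlocks₁₁ (F t).toBlocks₁₂ ((F t).toBlocks₁₂)ᵀ
      (F t).toBlocks₂₂ by rw [← h21, fromBlocks_toBlocks, hF], stdJ_mul_hamMatrix,
      fromBlocks_transpose, fromBlocks_multiply, fromBlocks_multiply, fromBlocks_add] at h
    exact hasDerivAt_toBlocks h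
  have hrel := fun t => by
    have h := hFs t
    rw [← SymplecticGroup.transpose_mem_iff, hFt, ← fromBlocks_toBlocks (F t), h21,
      SymplecticGroup.fromBlocks_mem_iff] at h
    exact h
  obtain ⟨w, hw, hS, hwa⟩ := exists_envelope_of_covariance (κ := κ) hRc hmc hms hm
    (a := fun t => (F t).toBlocks₁₁) (b := fun t => (F t).toBlocks₁₂)
    (d := fun t => (F t).toBlocks₂₂) (fun t => (hFpos t).submatrix Sum.inl_injective)
    (fun t => by
      have := (hrel t).1
      rw [h11, transpose_transpose] at this
      exact this.symm)
    (fun t => by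
      have := (hrel t).2.2
      rwa [h11, transpose_transpose] at this)
    (fun t => by
      have := (hder t).1
      rwa [transpose_transpose, transpose_nonsing_inv, (hms t).eq] at this)
    (fun t => by
      have := (hder t).2
      rwa [transpose_neg, transpose_neg, (hκs t).eq] at this)
  refine ⟨w, hw, hS, fun t => ?_⟩
  simp only [matAbs, hwa, hFT]

end Necessity

/-! ### An envelope matrix implies stability -/

section Sufficiency

variable {n : ℕ} {κ R m w : ℝ → Mat n}

open Matrix in
theorem dotProduct_mulVec_comm_of_isSymm {G : Mat n} (hG : G.IsSymm) (u v : Fin n → ℝ) :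
    u ⬝ᵥ (G *ᵥ v) = v ⬝ᵥ (G *ᵥ u) := by
  rw [dotProduct_mulVec, ← mulVec_transpose, hG.eq, dotProduct_comm]

theorem _root_.HasDerivAt.dotProduct' {ι : Type*} [Fintype ι] {f g : ℝ → ι → ℝ} {f' g' : ι → ℝ}
    {t : ℝ} (hf : HasDerivAt f f' t) (hg : HasDerivAt g g' t) :
    HasDerivAt (fun s => f s ⬝ᵥ g s) (f' ⬝ᵥ g t + f t ⬝ᵥ g') t := by
  rw [hasDerivAt_pi] at hf hg
  simp only [dotProduct, ← Finset.sum_add_distrib]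
  exact HasDerivAt.fun_sum fun k _ => (hf k).mul (hg k)

/-- The conjugate momentum `ẇ m - w R m` of an envelope matrix `w`. -/
noncomputable def envelopeMomentum (R m w : ℝ → Mat n) (t : ℝ) : Mat n :=
  deriv w t * m t - w t * R t * m t

open Matrix in
theorem IsEnvelopeSolution.hasDerivAt (hm : ∀ t, IsUnit (m t).det)
    (hw : IsEnvelopeSolution κ R m w) (t : ℝ) :
    HasDerivAt w (envelopeMomentum R m w t * (m t)⁻¹ + w t * R t) t := by
  have h := matrix_hasDerivAt_deriv hw.2.1 t
  have e : envelopeMomentum R m w t * (m t)⁻¹ + w t * R t = deriv w t := by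
    rw [envelopeMomentum, sub_mul, mul_assoc, mul_assoc _ _ (m t)⁻¹, mul_nonsing_inv _ (hm t)]
    simp
  rwa [e]

open Matrix in
theorem IsEnvelopeSolution.hasDerivAt_momentum (hw : IsEnvelopeSolution κ R m w) (t : ℝ) :
    HasDerivAt (envelopeMomentum R m w)
      (((w t)ᵀ)⁻¹ * (m t)⁻¹ * (w t)⁻¹ * ((w t)ᵀ)⁻¹ - envelopeMomentum R m w t * (R t)ᵀ
        - w t * κ t) t := by
  have h := matrix_hasDerivAt_deriv hw.2.2.1 t
  have e : ((w t)ᵀ)⁻¹ * (m t)⁻¹ * (w t)⁻¹ * ((w t)ᵀ)⁻¹ - envelopeMomentum R m w t * (R t)ᵀ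
      - w t * κ t = deriv (fun s => deriv w s * m s - w s * R s * m s) t := by
    have h1 := hw.2.2.2 t
    have h2 : ((w t)ᵀ * w t * m t * (w t)ᵀ)⁻¹ = ((w t)ᵀ)⁻¹ * (m t)⁻¹ * (w t)⁻¹ * ((w t)ᵀ)⁻¹ := by
      simp only [Matrix.mul_inv_rev, mul_assoc]
    rw [← h2, ← sub_eq_zero, ← neg_eq_zero, ← h1, envelopeMomentum]
    noncomm_ring
  rw [e]
  exact h

open Matrix in
-- With `P` the momentum, the derivative of `P wᵀ` is symmetric, so its antisymmetric part is
-- constant; the symplecticity of `S 0` makes it vanish at time `0`. This propagates the only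
-- nontrivial symplectic condition on `S` to all times.
theorem IsEnvelopeSolution.inv_mul_momentum_isSymm (hκs : ∀ t, (κ t).IsSymm)
    (hms : ∀ t, (m t).IsSymm) (hm : ∀ t, IsUnit (m t).det) (hw : IsEnvelopeSolution κ R m w)
    (hS : envelopeS R m w 0 ∈ symplecticGroup (Fin n) ℝ) (t : ℝ) :
    ((w t)⁻¹ * envelopeMomentum R m w t).IsSymm := by
  obtain ⟨P, hP⟩ : ∃ P, P = envelopeMomentum R m w := ⟨_, rfl⟩
  have hw' := hw.hasDerivAt hm
  have hP' := hw.hasDerivAt_momentum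
  rw [← hP] at hw' hP' ⊢
  have hmit : ∀ t, ((m t)⁻¹)ᵀ = (m t)⁻¹ := fun t => by rw [transpose_nonsing_inv, (hms t).eq]
  have hwtu : ∀ t, IsUnit ((w t)ᵀ).det := fun t => by rw [det_transpose]; exact hw.1 t
  have hwi : ∀ t, (w t)⁻¹ * w t = 1 := fun t => nonsing_inv_mul _ (hw.1 t)
  have hwi' : ∀ t, w t * (w t)⁻¹ = 1 := fun t => mul_nonsing_inv _ (hw.1 t)
  have hwti : ∀ t, ((w t)ᵀ)⁻¹ * (w t)ᵀ = 1 := fun t => nonsing_inv_mul _ (hwtu t)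
  have hwit : ∀ t, ((w t)⁻¹)ᵀ = ((w t)ᵀ)⁻¹ := fun t => transpose_nonsing_inv _
  have hconst : ∀ t, HasDerivAt (fun s => P s * (w s)ᵀ - (P s * (w s)ᵀ)ᵀ) 0 t := by
    intro t
    have h1 := (hP' t).matrix_mul (hw' t).matrix_transpose
    have e : (((w t)ᵀ)⁻¹ * (m t)⁻¹ * (w t)⁻¹ * ((w t)ᵀ)⁻¹ - P t * (R t)ᵀ - w t * κ t) * (w t)ᵀ +
        P t * (P t * (m t)⁻¹ + w t * R t)ᵀ =
        ((w t)ᵀ)⁻¹ * (m t)⁻¹ * (w t)⁻¹ - w t * κ t * (w t)ᵀ + P t * (m t)⁻¹ * (P t)ᵀ := by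
      simp only [transpose_add, transpose_mul, hmit]
      calc _ = ((w t)ᵀ)⁻¹ * (m t)⁻¹ * (w t)⁻¹ * (((w t)ᵀ)⁻¹ * (w t)ᵀ) - w t * κ t * (w t)ᵀ
            + P t * (m t)⁻¹ * (P t)ᵀ := by noncomm_ring
        _ = _ := by rw [hwti, mul_one]
    rw [e] at h1
    have h2 := h1.matrix_transpose
    have e2 : (((w t)ᵀ)⁻¹ * (m t)⁻¹ * (w t)⁻¹ - w t * κ t * (w t)ᵀ + P t * (m t)⁻¹ * (P t)ᵀ)ᵀ =
        ((w t)ᵀ)⁻¹ * (m t)⁻¹ * (w t)⁻¹ - w t * κ t * (w t)ᵀ + P t * (m t)⁻¹ * (P t)ᵀ := by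
      simp [transpose_mul, transpose_nonsing_inv, (hms t).eq, (hκs t).eq, mul_assoc]
    rw [e2] at h2
    rw [hasDerivAt_matrix_iff] at *
    intro i j
    have := (h1 i j).sub (h2 i j)
    rwa [sub_self] at this
  have hzero : P 0 * (w 0)ᵀ - (P 0 * (w 0)ᵀ)ᵀ = 0 := by
    have hC : (w 0 * R 0 - deriv w 0) * m 0 = -P 0 := by
      rw [hP, envelopeMomentum, sub_mul]; abel
    rw [envelopeS, hC, SymplecticGroup.fromBlocks_mem_iff] at hS
    have h := hS.1
    rw [transpose_nonsing_inv, transpose_transpose, transpose_neg, mul_neg, neg_mul,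
      neg_inj] at h
    rw [transpose_mul, transpose_transpose, sub_eq_zero]
    calc P 0 * (w 0)ᵀ = w 0 * ((w 0)⁻¹ * P 0) * (w 0)ᵀ := by rw [← mul_assoc, hwi', one_mul]
      _ = w 0 * (P 0)ᵀ * (((w 0)ᵀ)⁻¹ * (w 0)ᵀ) := by rw [h]; noncomm_ring
      _ = _ := by rw [hwti, mul_one]
  have ht := (matrix_eq_const_of_hasDerivAt_zero hconst t 0).trans hzero
  rw [transpose_mul, transpose_transpose, sub_eq_zero] at ht
  rw [IsSymm, transpose_mul, hwit]
  calc (P t)ᵀ * ((w t)ᵀ)⁻¹ = (w t)⁻¹ * (w t * (P t)ᵀ) * ((w t)ᵀ)⁻¹ := by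
        rw [← mul_assoc, hwi, one_mul]
    _ = (w t)⁻¹ * P t * ((w t)ᵀ * ((w t)ᵀ)⁻¹) := by rw [← ht]; noncomm_ring
    _ = _ := by rw [mul_nonsing_inv _ (hwtu t), mul_one]

open Matrix in
/-- The transformed solution `S z` rotates, so that its Euclidean length is conserved. -/
theorem IsEnvelopeSolution.dotProduct_le (hκs : ∀ t, (κ t).IsSymm)
    (hms : ∀ t, (m t).IsSymm) (hm : ∀ t, IsUnit (m t).det) (hw : IsEnvelopeSolution κ R m w)
    (hS : envelopeS R m w 0 ∈ symplecticGroup (Fin n) ℝ) {z : ℝ → Phase n}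
    (hz : IsHamSolution κ R m z) :
    ∃ e : ℝ, ∀ t, (((w t)ᵀ)⁻¹ *ᵥ (z t ∘ Sum.inl)) ⬝ᵥ (((w t)ᵀ)⁻¹ *ᵥ (z t ∘ Sum.inl)) ≤ e := by
  have hsymm := hw.inv_mul_momentum_isSymm hκs hms hm hS
  obtain ⟨P, hP⟩ : ∃ P, P = envelopeMomentum R m w := ⟨_, rfl⟩
  have hw' := hw.hasDerivAt hm
  have hP' := hw.hasDerivAt_momentum
  rw [← hP] at hw' hP' hsymm
  obtain ⟨x, hx⟩ : ∃ x : ℝ → Fin n → ℝ, x = fun t => z t ∘ Sum.inl := ⟨_, rfl⟩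
  obtain ⟨p, hp⟩ : ∃ p : ℝ → Fin n → ℝ, p = fun t => z t ∘ Sum.inr := ⟨_, rfl⟩
  have hx' : ∀ t, HasDerivAt x ((R t)ᵀ *ᵥ x t + (m t)⁻¹ *ᵥ p t) t := by
    rw [hx, hp]; exact hz.hasDerivAt_position
  have hp' : ∀ t, HasDerivAt p (-κ t *ᵥ x t + -R t *ᵥ p t) t := by
    rw [hx, hp]; exact hz.hasDerivAt_momentum
  have hmit : ∀ t, ((m t)⁻¹)ᵀ = (m t)⁻¹ := fun t => by rw [transpose_nonsing_inv, (hms t).eq]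
  have hwtu : ∀ t, IsUnit ((w t)ᵀ).det := fun t => by rw [det_transpose]; exact hw.1 t
  have hwi : ∀ t, (w t)⁻¹ * w t = 1 := fun t => nonsing_inv_mul _ (hw.1 t)
  have hwti : ∀ t, ((w t)ᵀ)⁻¹ * (w t)ᵀ = 1 := fun t => nonsing_inv_mul _ (hwtu t)
  have hwit : ∀ t, ((w t)⁻¹)ᵀ = ((w t)ᵀ)⁻¹ := fun t => transpose_nonsing_inv _
  obtain ⟨G, hG⟩ : ∃ G : ℝ → Mat n, ∀ t, G t = ((w t)ᵀ)⁻¹ * (m t)⁻¹ * (w t)⁻¹ :=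
    ⟨_, fun _ => rfl⟩
  have hGs : ∀ t, (G t).IsSymm := fun t => by
    rw [IsSymm, hG]
    simp [transpose_mul, transpose_nonsing_inv, (hms t).eq, mul_assoc]
  have h1 : ∀ t, HasDerivAt (fun s => ((w s)ᵀ)⁻¹ *ᵥ x s)
      (G t *ᵥ (w t *ᵥ p t - P t *ᵥ x t)) t := by
    intro t
    have h := ((hw' t).matrix_transpose.matrix_inv (hwtu t)).matrix_mulVec (hx' t)
    have e1 : ((w t)ᵀ)⁻¹ * (P t * (m t)⁻¹ + w t * R t)ᵀ * ((w t)ᵀ)⁻¹ =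
        G t * P t + ((w t)ᵀ)⁻¹ * (R t)ᵀ := by
      -- The symmetry of `w⁻¹ P` enters here: without it the derivative of `(wᵀ)⁻¹ x` would not be
      -- expressible through `w p - P x` alone.
      have hs : (P t)ᵀ * ((w t)ᵀ)⁻¹ = (w t)⁻¹ * P t := by
        have := (hsymm t).eq
        rwa [transpose_mul, hwit] at this
      rw [transpose_add, transpose_mul, transpose_mul, hmit, hG]
      calc _ = ((w t)ᵀ)⁻¹ * (m t)⁻¹ * ((P t)ᵀ * ((w t)ᵀ)⁻¹) +
            ((w t)ᵀ)⁻¹ * (R t)ᵀ * ((w t)ᵀ * ((w t)ᵀ)⁻¹) := by noncomm_ring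
        _ = _ := by rw [hs, mul_nonsing_inv _ (hwtu t), mul_one]; noncomm_ring
    have e2 : G t * w t = ((w t)ᵀ)⁻¹ * (m t)⁻¹ := by rw [hG, mul_assoc, hwi, mul_one]
    have e3 : -(((w t)ᵀ)⁻¹ * (P t * (m t)⁻¹ + w t * R t)ᵀ * ((w t)ᵀ)⁻¹) *ᵥ x t +
        ((w t)ᵀ)⁻¹ *ᵥ ((R t)ᵀ *ᵥ x t + (m t)⁻¹ *ᵥ p t) =
        G t *ᵥ (w t *ᵥ p t - P t *ᵥ x t) := by
      rw [e1, mulVec_sub, mulVec_add, mulVec_mulVec, mulVec_mulVec, mulVec_mulVec, mulVec_mulVec,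
        e2, neg_mulVec, add_mulVec]
      abel
    rwa [e3] at h
  have h2 : ∀ t, HasDerivAt (fun s => w s *ᵥ p s - P s *ᵥ x s)
      (-(G t *ᵥ (((w t)ᵀ)⁻¹ *ᵥ x t))) t := by
    intro t
    have h := ((hw' t).matrix_mulVec (hp' t)).sub ((hP' t).matrix_mulVec (hx' t))
    have e : (P t * (m t)⁻¹ + w t * R t) *ᵥ p t + w t *ᵥ (-κ t *ᵥ x t + -R t *ᵥ p t) -
        ((((w t)ᵀ)⁻¹ * (m t)⁻¹ * (w t)⁻¹ * ((w t)ᵀ)⁻¹ - P t * (R t)ᵀ - w t * κ t) *ᵥ x t +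
          P t *ᵥ ((R t)ᵀ *ᵥ x t + (m t)⁻¹ *ᵥ p t)) = -(G t *ᵥ (((w t)ᵀ)⁻¹ *ᵥ x t)) := by
      simp only [hG, mulVec_add, add_mulVec, sub_mulVec, neg_mulVec, mulVec_neg, mulVec_mulVec]
      abel
    rw [e] at h
    exact h
  have h3 : ∀ t, HasDerivAt (fun s => (((w s)ᵀ)⁻¹ *ᵥ x s) ⬝ᵥ (((w s)ᵀ)⁻¹ *ᵥ x s) +
      (w s *ᵥ p s - P s *ᵥ x s) ⬝ᵥ (w s *ᵥ p s - P s *ᵥ x s)) 0 t := by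
    intro t
    have h := ((h1 t).dotProduct' (h1 t)).add ((h2 t).dotProduct' (h2 t))
    refine h.congr_deriv ?_
    -- The two halves contribute `2 y₁ ⬝ᵥ G y₂` and `-2 y₂ ⬝ᵥ G y₁`, which cancel because `G` is
    -- symmetric.
    rw [dotProduct_comm (G t *ᵥ _), neg_dotProduct, dotProduct_neg,
      dotProduct_comm (G t *ᵥ (((w t)ᵀ)⁻¹ *ᵥ x t)),
      dotProduct_mulVec_comm_of_isSymm (hGs t) (w t *ᵥ p t - P t *ᵥ x t)]
    ring
  refine ⟨_, fun t => le_trans ?_ (is_const_of_deriv_eq_zero (fun t => (h3 t).differentiableAt)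
    (fun t => (h3 t).deriv) t 0).le⟩
  have hnn : ∀ v : Fin n → ℝ, 0 ≤ v ⬝ᵥ v := fun v => by simpa using dotProduct_self_star_nonneg v
  rw [hx]
  exact le_add_of_nonneg_right (hnn _)

open Matrix in
theorem exists_abs_apply_le_of_periodic {ι : Type*} [Fintype ι] {f : ℝ → Matrix ι ι ℝ}
    (hf : Continuous f) {T : ℝ} (hT : 0 < T) (hfT : Function.Periodic f T) :
    ∃ C : ℝ, 0 ≤ C ∧ ∀ t i, |f t i i| ≤ C := by
  choose c hc using fun i => (isCompact_Icc (a := (0 : ℝ)) (b := T)).bddAbove_image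
    (hf.matrix_elem i i).abs.continuousOn
  refine ⟨∑ i, |c i|, Finset.sum_nonneg fun _ _ => abs_nonneg _, fun t i => ?_⟩
  obtain ⟨s, hs, hst⟩ := hfT.exists_mem_Ico₀ hT t
  rw [hst]
  exact ((hc i ⟨s, ⟨hs.1, hs.2.le⟩, rfl⟩).trans (le_abs_self _)).trans
      (Finset.single_le_sum (f := fun i => |c i|) (fun j _ => abs_nonneg _) (Finset.mem_univ i))

open Matrix in
theorem isStable_of_envelope {T : ℝ} (hT : 0 < T)
    (hκc : Continuous κ) (hRc : Continuous R) (hmc : Continuous m)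
    (hκT : Function.Periodic κ T) (hRT : Function.Periodic R T) (hmT : Function.Periodic m T)
    (hκs : ∀ t, (κ t).IsSymm) (hms : ∀ t, (m t).IsSymm) (hm : ∀ t, IsUnit (m t).det)
    (hw : IsEnvelopeSolution κ R m w) (hS : envelopeS R m w 0 ∈ symplecticGroup (Fin n) ℝ)
    (hper : Function.Periodic (fun t => matAbs (w t)) T) : IsStable κ R m := by
  intro z hz
  have hsq : ∀ t, matAbs (w t) * matAbs (w t) = (w t)ᵀ * w t := fun t => by
    refine CFC.sqrt_mul_sqrt_self _ ?_
    simpa using (posSemidef_conjTranspose_mul_self (w t)).nonneg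
  have hQT : Function.Periodic (fun t => (w t)ᵀ * w t) T := fun t => by
    have h := hper t
    simp only at h
    simp only [← hsq, h]
  have hwc : Continuous w := continuous_of_matrix_hasDerivAt (matrix_hasDerivAt_deriv hw.2.1)
  obtain ⟨q, hq0, hq⟩ := exists_abs_apply_le_of_periodic
    (hwc.matrix_transpose.matrix_mul hwc) hT hQT
  obtain ⟨e, he⟩ := hw.dotProduct_le hκs hms hm hS hz
  have hwtu : ∀ t, IsUnit ((w t)ᵀ).det := fun t => by rw [det_transpose]; exact hw.1 t
  obtain ⟨C, hC⟩ := hz.bounded_of_position_bounded hT hκc hRc hmc hκT hRT hmT hm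
    -- Cauchy–Schwarz on `x = wᵀ y`: the `i`-th row of `wᵀ` has squared length `(wᵀ w) i i ≤ q`, and
    -- `y ⬝ᵥ y ≤ e` by conservation. Only diagonal entries of the periodic matrix `wᵀ w` are needed.
    (C := √(q * e)) fun t => by
      refine (pi_norm_le_iff_of_nonneg (Real.sqrt_nonneg _)).2 fun i => Real.abs_le_sqrt ?_
      set y := ((w t)ᵀ)⁻¹ *ᵥ (z t ∘ Sum.inl) with hy
      have hxy : z t ∘ Sum.inl = (w t)ᵀ *ᵥ y := by
        rw [hy, mulVec_mulVec, mul_nonsing_inv _ (hwtu t), one_mulVec]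
      rw [hxy]
      refine (Finset.sum_mul_sq_le_sq_mul_sq Finset.univ ((w t)ᵀ i) y).trans ?_
      have h1 : ∑ j, (w t)ᵀ i j ^ 2 = ((w t)ᵀ * w t) i i := by
        simp [mul_apply, sq]
      have h2 : ∑ j, y j ^ 2 = y ⬝ᵥ y := by simp [dotProduct, sq]
      rw [h1, h2]
      exact mul_le_mul ((le_abs_self _).trans (hq t i)) (he t)
        (by simpa using dotProduct_self_star_nonneg y) hq0
  exact ⟨C, fun t _ => hC t⟩

end Sufficiency

end LinHam

theorem theorem2 (n : ℕ) (T : ℝ) (hT : 0 < T) (κ R m : ℝ → LinHam.Mat n)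
    (hκc : Continuous κ) (hRc : Continuous R) (hmc : Continuous m)
    (hκT : Function.Periodic κ T) (hRT : Function.Periodic R T) (hmT : Function.Periodic m T)
    (hκs : ∀ t, (κ t).IsSymm) (hms : ∀ t, (m t).IsSymm) (hm : ∀ t, IsUnit (m t).det) :
    LinHam.IsStable κ R m ↔
      ∃ w : ℝ → LinHam.Mat n,
        LinHam.IsEnvelopeSolution κ R m w ∧
        LinHam.envelopeS R m w 0 ∈ Matrix.symplecticGroup (Fin n) ℝ ∧
        Function.Periodic (fun t => LinHam.matAbs (w t)) T := by
  refine ⟨LinHam.exists_envelope_of_isStable hT hκc hRc hmc hκT hRT hmT hκs hms hm, ?_⟩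
  rintro ⟨w, hw, hS, hper⟩
  exact LinHam.isStable_of_envelope hT hκc hRc hmc hκT hRT hmT hκs hms hm hw hS hper
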